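/- Consider the 4th-order ODE \[ u''''=F(u',u'',u'''),\qquad F(p,q,r)=-3\frac{q^3}{p^2}+4\frac{qr}{p},\qquad (p\neq 0), \] that is, $\frac{u''''}{u'}=-3\frac{(u'')^3}{(u')^3}+4\frac{u'''u''}{(u')^2}$. Let $(t,u,p,q,r)$ be the standard coordinates on the space of 3-jets of functions $\mathbb R\to\mathbb R$, let $J^3$ denote its open subset $\{p\neq0\}$, let $\frac{d}{dt}=X_F=\partial_t+p\,\partial_u+q\,\partial_p+r\,\partial_q+F\,\partial_r$, and let $S(u)=\frac{u'''}{u'}-\frac32\left(\frac{u''}{u'}\right)^2=\frac rp-\frac32\left(\frac qp\right)^2$ be the Schwarzian derivative. Bryant's generalized Wünschmann invariants of $u''''=F$ are \[ W_1=\tfrac94F_r\tfrac{d}{dt}F_r-\tfrac32\tfrac{d^2}{dt^2}F_r+3\tfrac{d}{dt}F_q-\tfrac38F_r^3-\tfrac32F_qF_r-3F_p, \] \[ \begin{aligned} W_0={}&\tfrac{11}{1600}F_r^4-\tfrac{9}{50}F_r^2\tfrac{d}{dt}F_r-\tfrac1{200}F_r^2F_q+\tfrac{21}{100}\left(\tfrac{d}{dt}F_r\right)^2+\tfrac1{50}\left(\tfrac{d}{dt}F_r\right)F_q-\tfrac9{100}F_q^2\\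 &+\tfrac7{20}F_r\tfrac{d^2}{dt^2}F_r-\tfrac15\tfrac{d^3}{dt^3}F_r+\tfrac3{10}\tfrac{d^2}{dt^2}F_q-\tfrac14F_r\tfrac{d}{dt}F_q . \end{aligned} \] **Theorem.** (1) On $J^3$ one has $W_1=0$ and $W_0=-\frac{36}{100}S(u)^2$. (2) The solution space $\mathcal M=J^3/X_F$ (the space of integral curves of $X_F$, with the quotient topology) has a smooth 4-dimensional structure for which the quotient map $\pi\colon J^3\to\mathcal M$ is a smooth submersion. (3) For any such structure, $\pi_*(\mathrm{span}(\partial_r))$ defines a field of curves in the projective tangent bundle $P(T\mathcal M)$: for a solution $s\in\mathcal M$, defined on its maximal interval $I_s$ (an open interval), the curve in $P(T_s\mathcal M)$ is $t\mapsto c_s(t)=\pi_*(\mathrm{span}(\partial_r))$, the image being taken at the 3-jet of $s$ at $t\in I_s$; each $c_s(t)$ is a line in $T_s\mathcal M$. This curve is - (a) projectively equivalent to $\Gamma(t)=(e^{-t},t,-e^t)$ if $S(u)<0$ for the solution $s$, - (b) projectively equivalent to $\Gamma(t)=(t-\sin t,\cos t,t+\sin t)$ if $S(u)>0$ for the solution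 $s$, - (c) projectively equivalent to the rational normal curve $\Gamma(t)=(t,t^2,t^3)$ if $S(u)=0$ for the solution $s$. Here $\Gamma$ is read in $P(\mathbb R^4)$ as $t\mapsto(1:\Gamma_1(t):\Gamma_2(t):\Gamma_3(t))$, and "projectively equivalent" means that there are a linear isomorphism $A\colon T_s\mathcal M\to\mathbb R^4$ and a constant $\kappa>0$ such that the projective map induced by $A$ sends $c_s(t)$ to $\Gamma(\kappa t)$ for all $t\in I_s$. -/

import Mathlib

open scoped Manifold ContDiff LinearAlgebra.Projectivization

noncomputable section

/-! Coordinates on the space of 3-jets of functions `ℝ → ℝ` are `(t, u, p, q, r)`, numbered `0, …, 4`;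
on the jet of `u` they are `(t, u, u', u'', u''')`. -/

/-- The coordinate vector field `∂ᵢ` (`i = 0, …, 4` for `t, u, p, q, r`). -/
def coordVec (i : Fin 5) : Fin 5 → ℝ := Pi.single i 1

/-- The partial derivative of `f` with respect to the `i`-th jet coordinate. -/
def jetPartial (i : Fin 5) (f : (Fin 5 → ℝ) → ℝ) : (Fin 5 → ℝ) → ℝ :=
  fun x => fderiv ℝ f x (coordVec i)

/-- The total derivative vector field `X_F = ∂_t + p ∂_u + q ∂_p + r ∂_q + F ∂_r` of the equation
`u'''' = F(t, u, u', u'', u''')`. -/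
def totalField (F : (Fin 5 → ℝ) → ℝ) (x : Fin 5 → ℝ) : Fin 5 → ℝ :=
  ![1, x 2, x 3, x 4, F x]

/-- The total derivative `d/dt` of the equation `u'''' = F`, acting on functions of 3-jets. -/
def totalDeriv (F f : (Fin 5 → ℝ) → ℝ) : (Fin 5 → ℝ) → ℝ :=
  fun x => fderiv ℝ f x (totalField F x)

/-- Bryant's generalized Wünschmann invariant `W₁` of the equation `u'''' = F`. -/
def wunschmannOne (F : (Fin 5 → ℝ) → ℝ) (x : Fin 5 → ℝ) : ℝ :=
  let Fp := jetPartial 2 F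
  let Fq := jetPartial 3 F
  let Fr := jetPartial 4 F
  let D := totalDeriv F
  9 / 4 * Fr x * D Fr x - 3 / 2 * D (D Fr) x + 3 * D Fq x - 3 / 8 * Fr x ^ 3
    - 3 / 2 * Fq x * Fr x - 3 * Fp x

/-- Bryant's generalized Wünschmann invariant `W₀` of the equation `u'''' = F`. -/
def wunschmannZero (F : (Fin 5 → ℝ) → ℝ) (x : Fin 5 → ℝ) : ℝ :=
  let Fq := jetPartial 3 F
  let Fr := jetPartial 4 F
  let D := totalDeriv F
  11 / 1600 * Fr x ^ 4 - 9 / 50 * Fr x ^ 2 * D Fr x - 1 / 200 * Fr x ^ 2 * Fq x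
    + 21 / 100 * D Fr x ^ 2 + 1 / 50 * D Fr x * Fq x - 9 / 100 * Fq x ^ 2
    + 7 / 20 * Fr x * D (D Fr) x - 1 / 5 * D (D (D Fr)) x + 3 / 10 * D (D Fq) x
    - 1 / 4 * Fr x * D Fq x

/-- The right-hand side `F = -3 q³ / p² + 4 q r / p` of the equation
`u'''' / u' = -3 (u'')³ / (u')³ + 4 u''' u'' / (u')²`, solved for `u''''`. -/
def eqRHS (x : Fin 5 → ℝ) : ℝ :=
  -3 * x 3 ^ 3 / x 2 ^ 2 + 4 * (x 3 * x 4) / x 2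

/-- The Schwarzian derivative `u''' / u' - (3/2) (u'' / u')²` as a function of the 3-jet of `u`. -/
def schwarzian (x : Fin 5 → ℝ) : ℝ :=
  x 4 / x 2 - 3 / 2 * (x 3 / x 2) ^ 2

/-- The part `p ≠ 0` of the 3-jet space, on which the equation is defined. -/
def jetSpace : TopologicalSpace.Opens (Fin 5 → ℝ) :=
  ⟨{x | x 2 ≠ 0}, isOpen_ne_fun (continuous_apply 2) continuous_const⟩

/-- `x` is joined to `y` by an integral curve of `X_F` that stays in the region `p ≠ 0`. -/
def flowsTo (x y : jetSpace) : Prop :=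
  ∃ (γ : ℝ → (Fin 5 → ℝ)) (a b : ℝ), a ≤ b ∧
    (∀ τ ∈ Set.Icc a b, γ τ ∈ jetSpace ∧
      HasDerivWithinAt γ (totalField eqRHS (γ τ)) (Set.Icc a b) τ) ∧
    γ a = x ∧ γ b = y

/-- The solution space `J³ / X_F`: two jets are identified (through the equivalence relation
generated by `flowsTo`) when they lie on the same integral curve of `X_F`, that is, on the
graph of the 3-jets of one solution. -/
def SolutionSpace : Type := Quot flowsTo

/-- The solution space carries the quotient topology. -/
instance : TopologicalSpace SolutionSpace :=
  inferInstanceAs (TopologicalSpace (Quot flowsTo))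

/-- The quotient map `π : J³ → J³ / X_F`. -/
def toSolution (x : jetSpace) : SolutionSpace := Quot.mk flowsTo x

/-- The differential of the quotient map `π` at a jet. -/
def dToSolution [ChartedSpace (Fin 4 → ℝ) SolutionSpace] (x : jetSpace) :
    TangentSpace 𝓘(ℝ, Fin 5 → ℝ) x →L[ℝ] TangentSpace 𝓘(ℝ, Fin 4 → ℝ) (toSolution x) :=
  mfderiv 𝓘(ℝ, Fin 5 → ℝ) 𝓘(ℝ, Fin 4 → ℝ) toSolution x

/-- The given atlas is a smooth structure of dimension 4 on the solution space for which the quotient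
map is a smooth submersion. (These conditions determine the maximal smooth atlas.) -/
def IsQuotientStructure (_ : ChartedSpace (Fin 4 → ℝ) SolutionSpace) : Prop :=
  IsManifold 𝓘(ℝ, Fin 4 → ℝ) ∞ SolutionSpace ∧
  ContMDiff 𝓘(ℝ, Fin 5 → ℝ) 𝓘(ℝ, Fin 4 → ℝ) ∞ toSolution ∧
  ∀ x : jetSpace, Function.Surjective (dToSolution x)

/-- The subspace `π_* (span ∂_r)` of the tangent space of the solution space at `π x`. -/
def verticalImage [ChartedSpace (Fin 4 → ℝ) SolutionSpace] (x : jetSpace) :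
    Submodule ℝ (TangentSpace 𝓘(ℝ, Fin 4 → ℝ) (toSolution x)) :=
  Submodule.map (dToSolution x).toLinearMap (Submodule.span ℝ {coordVec 4})

/-- The 3-jets of the solution `s`, that is, the integral curve of `X_F` that `s` stands for. -/
abbrev Leaf (s : SolutionSpace) : Type := {x : jetSpace // toSolution x = s}

/-- The value of `t` at a jet of the solution `s`. -/
def Leaf.time {s : SolutionSpace} (x : Leaf s) : ℝ := (x.1 : Fin 5 → ℝ) 0

/-- The point `(1 : x₁ : x₂ : x₃)` of real projective 3-space with affine coordinates `x`. -/
def affinePoint (x : Fin 3 → ℝ) : ℙ ℝ (Fin 4 → ℝ) :=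
  Projectivization.mk ℝ (Matrix.vecCons 1 x) (fun h => one_ne_zero (congrFun h 0))

/-- The curve `c` in the projective space of `V`, given along the leaf of `s`, is projectively
equivalent to the curve `Γ` in projective 3-space: `t` runs through an open interval, and some
projective isomorphism takes the point of `c` at `t` to `Γ (κ t)`, for a constant `κ > 0`. -/
def IsProjectivelyEquivalent {s : SolutionSpace} {V : Type*} [AddCommGroup V] [Module ℝ V]
    (c : Leaf s → ℙ ℝ V) (Γ : ℝ → (Fin 3 → ℝ)) : Prop :=
  IsOpen (Set.range (Leaf.time (s := s))) ∧ (Set.range (Leaf.time (s := s))).OrdConnected ∧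
  ∃ (A : V ≃ₗ[ℝ] (Fin 4 → ℝ)) (κ : ℝ), 0 < κ ∧
    ∀ x : Leaf s, (c x).map A.toLinearMap A.injective = affinePoint (Γ (κ * x.time))

end

/-! The equation says exactly that the Schwarzian S is constant along solutions. With v = u''/u' the
rest is the Riccati equation v' = S + v²/2, linearised by v = -2E'/E, where E'' = -(S/2)E. Hence u'
= u'(x₀)/E², and u is u(x₀) plus u'(x₀) times a quotient of two solutions of the linear equation. A
solution lives as long as E, normalised to 1 at the initial time, stays positive. Moreover F is
homogeneous of degree one in (p, q, r), its first partials are polynomials in v and S, and d/dt acts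
on such polynomials by the two rules above; this makes the Wünschmann invariants a finite
computation (`wunschmann_eqRHS`).

The values of (u, u', v, S) at a fixed time s are constant on leaves (`jetData_evol`) and serve as
charts on the solutions that reach s; they give the quotient structure. For any other admissible
structure, dπ is onto with kernel the line of X_F, and the differential of these data has the same
properties, so the tangent space is identified with ℝ⁴ whatever the atlas (`exists_tangentEquiv`).

A tangent vector to the solution space is a variation δu = f u' with δS = f''' + 2S f' constant, so
f'''' + 2S f'' = 0. The vector ∂_r at time t gives the f that vanishes to second order at t. Read at
a fixed time t₀ through (δS, f, f', f''), it is a multiple of (1, K, K', K'') at t₀ - t, where K is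
a fixed solution depending only on S (`jacobiMap_fderiv_jetData`). The components of this curve span
1, t together with cos and sin of √(2S) t, or exp(±√(-2S) t), or t² and t³, according to the sign of
S. A constant matrix then carries it to the model curve. -/

noncomputable section

/-! ### The functions v and S and their derivatives along X_F -/

/-- The logarithmic derivative `v = u'' / u'` of `u'` as a function of the 3-jet of `u`. -/
def jetV (x : Fin 5 → ℝ) : ℝ := x 3 / x 2

theorem jetSpace_mem_nhds {x : Fin 5 → ℝ} (hx : x ∈ jetSpace) :
    {y : Fin 5 → ℝ | y 2 ≠ 0} ∈ nhds x := jetSpace.isOpen.mem_nhds hx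

theorem contDiffAt_jetV {x : Fin 5 → ℝ} (hx : x 2 ≠ 0) : ContDiffAt ℝ ∞ jetV x :=
  (contDiffAt_apply ℝ ℝ 3 x).div (contDiffAt_apply ℝ ℝ 2 x) hx

theorem contDiffAt_schwarzian {x : Fin 5 → ℝ} (hx : x 2 ≠ 0) : ContDiffAt ℝ ∞ schwarzian x :=
  ((contDiffAt_apply ℝ ℝ 4 x).div (contDiffAt_apply ℝ ℝ 2 x) hx).sub
    (contDiffAt_const.mul ((contDiffAt_jetV hx).pow 2))

/-- Once differentiability is known, a directional derivative can be computed as a one-variable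
derivative along a line. -/
theorem fderiv_apply_eq_of_line {E F : Type*} [NormedAddCommGroup E] [NormedSpace ℝ E]
    [NormedAddCommGroup F] [NormedSpace ℝ F] {f : E → F} {x ξ : E} {d : F}
    (hf : DifferentiableAt ℝ f x) (h : HasDerivAt (fun s : ℝ => f (x + s • ξ)) d 0) :
    fderiv ℝ f x ξ = d :=
  (hf.hasFDerivAt.hasLineDerivAt ξ).unique h

theorem hasDerivAt_coord_line (x ξ : Fin 5 → ℝ) (i : Fin 5) :
    HasDerivAt (fun s : ℝ => (x + s • ξ) i) (ξ i) 0 := by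
  simpa using ((hasDerivAt_id (0 : ℝ)).mul_const (ξ i)).const_add (x i)

theorem fderiv_jetV {x : Fin 5 → ℝ} (hx : x 2 ≠ 0) (ξ : Fin 5 → ℝ) :
    fderiv ℝ jetV x ξ = (ξ 3 * x 2 - x 3 * ξ 2) / x 2 ^ 2 := by
  refine fderiv_apply_eq_of_line ((contDiffAt_jetV hx).differentiableAt (by simp)) ?_
  have h := (hasDerivAt_coord_line x ξ 3).div (hasDerivAt_coord_line x ξ 2) (by simpa using hx)
  exact h.congr_deriv (by simp)

theorem fderiv_schwarzian {x : Fin 5 → ℝ} (hx : x 2 ≠ 0) (ξ : Fin 5 → ℝ) :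
    fderiv ℝ schwarzian x ξ = (ξ 4 * x 2 - x 4 * ξ 2) / x 2 ^ 2
      - 3 * (x 3 / x 2) * ((ξ 3 * x 2 - x 3 * ξ 2) / x 2 ^ 2) := by
  refine fderiv_apply_eq_of_line ((contDiffAt_schwarzian hx).differentiableAt (by simp)) ?_
  have hx' : (x + (0 : ℝ) • ξ) 2 ≠ 0 := by simpa using hx
  have h := ((hasDerivAt_coord_line x ξ 4).div (hasDerivAt_coord_line x ξ 2) hx').sub
    ((((hasDerivAt_coord_line x ξ 3).div (hasDerivAt_coord_line x ξ 2) hx').pow 2).const_mul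
      (3 / 2))
  refine h.congr_deriv ?_
  simp
  ring

/-- The form in which the fourth derivative is recognised when the explicit solution is
differentiated. -/
theorem eqRHS_eq {x : Fin 5 → ℝ} (hx : x 2 ≠ 0) :
    eqRHS x = x 2 * (4 * jetV x * schwarzian x + 3 * jetV x ^ 3) := by
  simp only [eqRHS, jetV, schwarzian]
  field_simp
  ring

/-- Since dS/dt = F/p - 4qr/p² + 3q³/p³, the given F is the one that makes S a first integral. -/
theorem fderiv_schwarzian_totalField {x : Fin 5 → ℝ} (hx : x 2 ≠ 0) :
    fderiv ℝ schwarzian x (totalField eqRHS x) = 0 := by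
  rw [fderiv_schwarzian hx]
  simp [totalField, eqRHS]
  field_simp
  ring

/-- The Riccati equation of v, whose coefficient S is constant on each solution. -/
theorem fderiv_jetV_totalField {x : Fin 5 → ℝ} (hx : x 2 ≠ 0) :
    fderiv ℝ jetV x (totalField eqRHS x) = schwarzian x + jetV x ^ 2 / 2 := by
  rw [fderiv_jetV hx]
  simp [totalField, schwarzian, jetV]
  field_simp
  ring

/-! ### The Wünschmann invariants -/

/-- The total derivative of a function that is polynomial in `v` and `S`. -/
theorem totalDeriv_polynomial {f : (Fin 5 → ℝ) → ℝ} {a b c d e g : ℝ}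
    (hf : ∀ y ∈ jetSpace, f y = a * jetV y + b * schwarzian y + c * jetV y ^ 2
      + d * (jetV y * schwarzian y) + e * jetV y ^ 3 + g * jetV y ^ 4) {x : Fin 5 → ℝ}
    (hx : x ∈ jetSpace) :
    totalDeriv eqRHS f x = (schwarzian x + jetV x ^ 2 / 2)
      * (a + 2 * c * jetV x + d * schwarzian x + 3 * e * jetV x ^ 2 + 4 * g * jetV x ^ 3) := by
  have hx2 : x 2 ≠ 0 := hx
  have hv := ((contDiffAt_jetV hx2).differentiableAt (by simp)).hasFDerivAt
  have hS := ((contDiffAt_schwarzian hx2).differentiableAt (by simp)).hasFDerivAt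
  have h := (((((hv.const_mul a).add (hS.const_mul b)).add ((hv.pow 2).const_mul c)).add
    ((hv.mul hS).const_mul d)).add ((hv.pow 3).const_mul e)).add ((hv.pow 4).const_mul g)
  have e1 : f =ᶠ[nhds x] _ := Filter.eventuallyEq_of_mem (jetSpace_mem_nhds hx) hf
  rw [totalDeriv, (h.congr_of_eventuallyEq e1).fderiv]
  simp [fderiv_jetV_totalField hx2, fderiv_schwarzian_totalField hx2]
  ring

theorem contDiffAt_eqRHS {x : Fin 5 → ℝ} (hx : x 2 ≠ 0) : ContDiffAt ℝ ∞ eqRHS x :=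
  ((contDiffAt_const.mul ((contDiffAt_apply ℝ ℝ 3 x).pow 3)).div
    ((contDiffAt_apply ℝ ℝ 2 x).pow 2) (pow_ne_zero 2 hx)).add
    ((contDiffAt_const.mul ((contDiffAt_apply ℝ ℝ 3 x).mul (contDiffAt_apply ℝ ℝ 4 x))).div
      (contDiffAt_apply ℝ ℝ 2 x) hx)

/-- F is homogeneous of degree one in (p, q, r), so its partials have degree zero; they turn out to
be polynomials in v and S. -/
theorem fderiv_eqRHS {x : Fin 5 → ℝ} (hx : x 2 ≠ 0) (ξ : Fin 5 → ℝ) :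
    fderiv ℝ eqRHS x ξ = -4 * jetV x * schwarzian x * ξ 2
      + (4 * schwarzian x - 3 * jetV x ^ 2) * ξ 3 + 4 * jetV x * ξ 4 := by
  refine fderiv_apply_eq_of_line ((contDiffAt_eqRHS hx).differentiableAt (by simp)) ?_
  have hx' : (x + (0 : ℝ) • ξ) 2 ≠ 0 := by simpa using hx
  have h2 := hasDerivAt_coord_line x ξ 2
  have h3 := hasDerivAt_coord_line x ξ 3
  have h4 := hasDerivAt_coord_line x ξ 4
  refine ((((h3.pow 3).const_mul (-3)).div (h2.pow 2) (pow_ne_zero 2 hx')).add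
    (((h3.mul h4).const_mul 4).div h2 hx')).congr_deriv ?_
  simp [jetV, schwarzian]
  field_simp
  ring

theorem wunschmann_eqRHS {x : Fin 5 → ℝ} (hx : x ∈ jetSpace) :
    wunschmannOne eqRHS x = 0 ∧
      wunschmannZero eqRHS x = -(36 / 100) * schwarzian x ^ 2 := by
  have Fp : ∀ y ∈ jetSpace, jetPartial 2 eqRHS y = -4 * jetV y * schwarzian y := fun y hy => by
    rw [jetPartial, fderiv_eqRHS hy]; simp [coordVec]
  have Fq : ∀ y ∈ jetSpace, jetPartial 3 eqRHS y = 4 * schwarzian y - 3 * jetV y ^ 2 :=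
    fun y hy => by rw [jetPartial, fderiv_eqRHS hy]; simp [coordVec]
  have Fr : ∀ y ∈ jetSpace, jetPartial 4 eqRHS y = 4 * jetV y := fun y hy => by
    rw [jetPartial, fderiv_eqRHS hy]; simp [coordVec]
  have DFr : ∀ y ∈ jetSpace, totalDeriv eqRHS (jetPartial 4 eqRHS) y
      = 4 * schwarzian y + 2 * jetV y ^ 2 := fun y hy => by
    rw [totalDeriv_polynomial (a := 4) (b := 0) (c := 0) (d := 0) (e := 0) (g := 0)
      (fun y hy => by rw [Fr y hy]; ring) hy]
    ring
  have DDFr : ∀ y ∈ jetSpace, totalDeriv eqRHS (totalDeriv eqRHS (jetPartial 4 eqRHS)) y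
      = 4 * (jetV y * schwarzian y) + 2 * jetV y ^ 3 := fun y hy => by
    rw [totalDeriv_polynomial (a := 0) (b := 4) (c := 2) (d := 0) (e := 0) (g := 0)
      (fun y hy => by rw [DFr y hy]; ring) hy]
    ring
  have DFq : ∀ y ∈ jetSpace, totalDeriv eqRHS (jetPartial 3 eqRHS) y
      = -6 * (jetV y * schwarzian y) - 3 * jetV y ^ 3 := fun y hy => by
    rw [totalDeriv_polynomial (a := 0) (b := 4) (c := -3) (d := 0) (e := 0) (g := 0)
      (fun y hy => by rw [Fq y hy]; ring) hy]
    ring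
  have DDDFr := totalDeriv_polynomial
    (f := totalDeriv eqRHS (totalDeriv eqRHS (jetPartial 4 eqRHS)))
    (a := 0) (b := 0) (c := 0) (d := 4) (e := 2) (g := 0)
    (fun y hy => by rw [DDFr y hy]; ring) hx
  have DDFq := totalDeriv_polynomial
    (f := totalDeriv eqRHS (jetPartial 3 eqRHS))
    (a := 0) (b := 0) (c := 0) (d := -6) (e := -3) (g := 0)
    (fun y hy => by rw [DFq y hy]; ring) hx
  constructor
  · simp only [wunschmannOne, Fp x hx, Fq x hx, Fr x hx, DFr x hx, DDFr x hx, DFq x hx]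
    ring
  · simp only [wunschmannZero, Fq x hx, Fr x hx, DFr x hx, DDFr x hx, DFq x hx, DDDFr, DDFq]
    ring

/-! ### The linear equation y'' = -σy, uniformly in the sign of σ -/

section
attribute [local instance] Matrix.linftyOpNormedRing Matrix.linftyOpNormedAlgebra

/-- The matrix of the first-order system of `y'' = -σ y`. -/
def oscMatrix (σ : ℝ) : Matrix (Fin 2) (Fin 2) ℝ := !![0, 1; -σ, 0]

/-- The fundamental matrix of `y'' = -σ y`. -/
def oscExp (σ t : ℝ) : Matrix (Fin 2) (Fin 2) ℝ := NormedSpace.exp (t • oscMatrix σ)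

/-- The solution of `y'' = -σ y` with `y 0 = 1`, `y' 0 = 0`. -/
def oscC (σ t : ℝ) : ℝ := oscExp σ t 0 0

/-- The solution of `y'' = -σ y` with `y 0 = 0`, `y' 0 = 1`. -/
def oscS (σ t : ℝ) : ℝ := oscExp σ t 0 1

/-- The exponential is analytic and the matrix is affine in σ. Joint smoothness across σ = 0 is the
gain over a definition by cases with trigonometric and hyperbolic functions. -/
theorem contDiff_oscExp : ContDiff ℝ ∞ (fun z : ℝ × ℝ => oscExp z.1 z.2) := by
  have h : ContDiff ℝ ∞ (NormedSpace.exp : Matrix (Fin 2) (Fin 2) ℝ → _) :=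
    contDiff_iff_contDiffAt.2 fun x => (NormedSpace.exp_analytic (𝕂 := ℝ) x).contDiffAt
  refine h.comp (contDiff_snd.smul ?_)
  have e : (fun z : ℝ × ℝ => oscMatrix z.1)
      = fun z : ℝ × ℝ => !![0, 1; 0, 0] + z.1 • !![0, 0; (-1 : ℝ), 0] := by
    funext z; ext i j; fin_cases i <;> fin_cases j <;> simp [oscMatrix]
  rw [e]
  exact contDiff_const.add (contDiff_fst.smul contDiff_const)

/-- Evaluation of a matrix at an entry. -/
def entryCLM (i j : Fin 2) : Matrix (Fin 2) (Fin 2) ℝ →L[ℝ] ℝ :=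
  LinearMap.toContinuousLinearMap (Matrix.entryLinearMap ℝ ℝ i j)

theorem contDiff_oscC : ContDiff ℝ ∞ (fun z : ℝ × ℝ => oscC z.1 z.2) :=
  (entryCLM 0 0).contDiff.comp contDiff_oscExp

theorem contDiff_oscS : ContDiff ℝ ∞ (fun z : ℝ × ℝ => oscS z.1 z.2) :=
  (entryCLM 0 1).contDiff.comp contDiff_oscExp

theorem hasDerivAt_oscExp (σ t : ℝ) :
    HasDerivAt (oscExp σ) (oscExp σ t * oscMatrix σ) t :=
  hasDerivAt_exp_smul_const (𝕂 := ℝ) (oscMatrix σ) t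

theorem oscExp_commute (σ t : ℝ) : oscExp σ t * oscMatrix σ = oscMatrix σ * oscExp σ t :=
  (((Commute.refl (oscMatrix σ)).smul_right t).exp_right).eq.symm

/-- Commutation of the exponential with its generator expresses the second row through the first. -/
theorem oscExp_apply_one_zero (σ t : ℝ) : oscExp σ t 1 0 = -σ * oscS σ t := by
  have h := congrFun (congrFun (oscExp_commute σ t) 0) 0
  simp [Matrix.mul_apply, Fin.sum_univ_two, oscMatrix] at h
  rw [oscS]; linarith

theorem oscExp_apply_one_one (σ t : ℝ) : oscExp σ t 1 1 = oscC σ t := by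
  have h := congrFun (congrFun (oscExp_commute σ t) 0) 1
  simp [Matrix.mul_apply, Fin.sum_univ_two, oscMatrix] at h
  rw [oscC]; linarith

theorem hasDerivAt_oscC (σ t : ℝ) : HasDerivAt (oscC σ) (-σ * oscS σ t) t := by
  have h := (entryCLM 0 0).hasFDerivAt.comp_hasDerivAt t (hasDerivAt_oscExp σ t)
  have e : (entryCLM 0 0) (oscExp σ t * oscMatrix σ) = -σ * oscS σ t := by
    simp [entryCLM, Matrix.mul_apply, Fin.sum_univ_two, oscMatrix, oscS, mul_comm]
  exact h.congr_deriv e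

theorem hasDerivAt_oscS (σ t : ℝ) : HasDerivAt (oscS σ) (oscC σ t) t := by
  have h := (entryCLM 0 1).hasFDerivAt.comp_hasDerivAt t (hasDerivAt_oscExp σ t)
  have e : (entryCLM 0 1) (oscExp σ t * oscMatrix σ) = oscC σ t := by
    simp [entryCLM, Matrix.mul_apply, Fin.sum_univ_two, oscMatrix, oscC]
  exact h.congr_deriv e

theorem oscExp_add (σ s t : ℝ) : oscExp σ (s + t) = oscExp σ s * oscExp σ t := by
  rw [oscExp, add_smul]
  exact NormedSpace.exp_add_of_commute
    (((Commute.refl (oscMatrix σ)).smul_right t).smul_left s)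

@[simp] theorem oscExp_zero (σ : ℝ) : oscExp σ 0 = 1 := by
  rw [oscExp, zero_smul, NormedSpace.exp_zero]

end

@[simp] theorem oscC_zero (σ : ℝ) : oscC σ 0 = 1 := by simp [oscC]

@[simp] theorem oscS_zero (σ : ℝ) : oscS σ 0 = 0 := by simp [oscS]

theorem oscC_add (σ s t : ℝ) : oscC σ (s + t) = oscC σ s * oscC σ t - σ * oscS σ s * oscS σ t := by
  have h := congrFun (congrFun (oscExp_add σ s t) 0) 0
  rw [Matrix.mul_apply, Fin.sum_univ_two, oscExp_apply_one_zero] at h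
  rw [oscC, h, ← oscC, ← oscC, ← oscS]; ring

theorem oscS_add (σ s t : ℝ) : oscS σ (s + t) = oscC σ s * oscS σ t + oscS σ s * oscC σ t := by
  have h := congrFun (congrFun (oscExp_add σ s t) 0) 1
  rw [Matrix.mul_apply, Fin.sum_univ_two, oscExp_apply_one_one] at h
  rw [oscS, h, ← oscC, ← oscS, ← oscS]

/-- Conservation of energy, the common form of cos² + sin² = 1 and cosh² - sinh² = 1. -/
theorem oscC_sq_add (σ t : ℝ) : oscC σ t ^ 2 + σ * oscS σ t ^ 2 = 1 := by
  have h : ∀ t, HasDerivAt (fun t => oscC σ t ^ 2 + σ * oscS σ t ^ 2) 0 t := fun t => by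
    refine (((hasDerivAt_oscC σ t).pow 2).add
      (((hasDerivAt_oscS σ t).pow 2).const_mul σ)).congr_deriv ?_
    simp; ring
  have := is_const_of_deriv_eq_zero (fun t => (h t).differentiableAt) (fun t => (h t).deriv) t 0
  simpa using this

/-! ### Variation of σ and the function K -/

/-- The derivative of `oscC` with respect to `σ`. -/
def oscCσ (σ t : ℝ) : ℝ := deriv (fun s => oscC s t) σ

/-- The derivative of `oscS` with respect to `σ`. -/
def oscSσ (σ t : ℝ) : ℝ := deriv (fun s => oscS s t) σ

theorem hasDerivAt_oscC_left (σ t : ℝ) : HasDerivAt (fun s => oscC s t) (oscCσ σ t) σ :=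
  ((contDiff_oscC.comp (contDiff_id.prodMk contDiff_const)).differentiable
    (by simp) σ).hasDerivAt

theorem hasDerivAt_oscS_left (σ t : ℝ) : HasDerivAt (fun s => oscS s t) (oscSσ σ t) σ :=
  ((contDiff_oscS.comp (contDiff_id.prodMk contDiff_const)).differentiable
    (by simp) σ).hasDerivAt

/-- Partial derivatives of a smooth function of two real variables commute. -/
theorem hasDerivAt_deriv_swap {f g : ℝ → ℝ → ℝ} (hf : ContDiff ℝ ∞ (fun z : ℝ × ℝ => f z.1 z.2))
    (hg : ∀ s t, HasDerivAt (f s) (g s t) t) (s t : ℝ) {g' : ℝ}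
    (hg' : HasDerivAt (fun r => g r t) g' s) :
    HasDerivAt (fun r => deriv (fun q => f q r) s) g' t := by
  set F : ℝ × ℝ → ℝ := fun z => f z.1 z.2 with hF
  have hd : ∀ z, HasFDerivAt F (fderiv ℝ F z) z := fun z =>
    (hf.differentiable (by simp) z).hasFDerivAt
  have h1 : ∀ q r, deriv (fun q => f q r) q = fderiv ℝ F (q, r) (1, 0) := fun q r => by
    have := (hd (q, r)).comp_hasDerivAt q ((hasDerivAt_id q).prodMk (hasDerivAt_const q r))
    exact this.deriv
  have h2 : ∀ q r, g q r = fderiv ℝ F (q, r) (0, 1) := fun q r => by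
    have := (hd (q, r)).comp_hasDerivAt r ((hasDerivAt_const r q).prodMk (hasDerivAt_id r))
    exact (hg q r).unique this
  have hd2 : HasFDerivAt (fderiv ℝ F) (fderiv ℝ (fderiv ℝ F) (s, t)) (s, t) :=
    ((hf.fderiv_right (m := ∞) (by simp)).differentiable (by simp) (s, t)).hasFDerivAt
  have hsymm : IsSymmSndFDerivAt ℝ F (s, t) :=
    hf.contDiffAt.isSymmSndFDerivAt
      (by simpa using WithTop.coe_le_coe.2 (le_top : (2 : ℕ∞) ≤ ⊤))
  have h3 : HasDerivAt (fun r => fderiv ℝ F (s, r)) (fderiv ℝ (fderiv ℝ F) (s, t) (0, 1)) t :=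
    hd2.comp_hasDerivAt t ((hasDerivAt_const t s).prodMk (hasDerivAt_id t))
  have h4 : HasDerivAt (fun q => fderiv ℝ F (q, t)) (fderiv ℝ (fderiv ℝ F) (s, t) (1, 0)) s :=
    hd2.comp_hasDerivAt s ((hasDerivAt_id s).prodMk (hasDerivAt_const s t))
  have h5 := h3.clm_apply (hasDerivAt_const t ((1, 0) : ℝ × ℝ))
  have h6 := h4.clm_apply (hasDerivAt_const s ((0, 1) : ℝ × ℝ))
  simp only [map_zero, add_zero] at h5 h6
  simp only [h2] at hg'
  simp only [h1]
  rw [hg'.unique h6, hsymm]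
  exact h5

theorem hasDerivAt_oscSσ (σ t : ℝ) : HasDerivAt (oscSσ σ) (oscCσ σ t) t :=
  hasDerivAt_deriv_swap contDiff_oscS hasDerivAt_oscS σ t (hasDerivAt_oscC_left σ t)

theorem hasDerivAt_oscCσ (σ t : ℝ) :
    HasDerivAt (oscCσ σ) (-oscS σ t - σ * oscSσ σ t) t := by
  refine hasDerivAt_deriv_swap contDiff_oscC hasDerivAt_oscC σ t ?_
  refine (((hasDerivAt_id σ).neg).mul (hasDerivAt_oscS_left σ t)).congr_deriv ?_
  simp; ring

/-- The solution of `f'''' + 4 σ f'' = 0` with 3-jet `(0, 0, 0, 1)` at `0`. -/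
def oscK (σ t : ℝ) : ℝ := (oscSσ σ t * oscC σ t - oscS σ t * oscCσ σ t) / 2

/-- K is built from σ-derivatives because moving a jet along ∂_r moves S. In the time derivative all
σ-derivatives cancel; only the inhomogeneous term of the varied equation survives. -/
theorem hasDerivAt_oscK (σ t : ℝ) : HasDerivAt (oscK σ) (oscS σ t ^ 2 / 2) t := by
  refine ((((hasDerivAt_oscSσ σ t).mul (hasDerivAt_oscC σ t)).sub
    ((hasDerivAt_oscS σ t).mul (hasDerivAt_oscCσ σ t))).div_const 2).congr_deriv ?_
  ring

@[simp] theorem oscSσ_zero (σ : ℝ) : oscSσ σ 0 = 0 := by simp [oscSσ]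

@[simp] theorem oscCσ_zero (σ : ℝ) : oscCσ σ 0 = 0 := by simp [oscCσ]

@[simp] theorem oscK_zero (σ : ℝ) : oscK σ 0 = 0 := by simp [oscK]

theorem oscC_sq_deriv (σ t : ℝ) :
    2 * oscC σ t * oscCσ σ t + oscS σ t ^ 2 + 2 * σ * oscS σ t * oscSσ σ t = 0 := by
  have h := ((hasDerivAt_oscC_left σ t).pow 2).add
    ((hasDerivAt_id σ).mul ((hasDerivAt_oscS_left σ t).pow 2))
  have e : ((fun s => oscC s t) ^ 2 + id * (fun s => oscS s t) ^ 2) = fun _ : ℝ => (1 : ℝ) := by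
    funext s; exact oscC_sq_add s t
  rw [e] at h
  have := h.unique (hasDerivAt_const σ 1)
  simp at this
  linarith

/-! ### The explicit flow of X_F -/

/-- Along the solution through the jet `x`, the function with `u' (s) = u' (x₀) / (dev x s) ^ 2`. -/
def dev (x : Fin 5 → ℝ) (s : ℝ) : ℝ :=
  oscC (schwarzian x / 2) (s - x 0) - jetV x / 2 * oscS (schwarzian x / 2) (s - x 0)

/-- The derivative of `dev x`. -/
def devDeriv (x : Fin 5 → ℝ) (s : ℝ) : ℝ :=
  -(schwarzian x / 2) * oscS (schwarzian x / 2) (s - x 0)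
    - jetV x / 2 * oscC (schwarzian x / 2) (s - x 0)

theorem hasDerivAt_dev (x : Fin 5 → ℝ) (s : ℝ) : HasDerivAt (dev x) (devDeriv x s) s :=
  ((hasDerivAt_oscC _ _).comp_sub_const s (x 0)).sub
    (((hasDerivAt_oscS _ _).comp_sub_const s (x 0)).const_mul _)

theorem hasDerivAt_devDeriv (x : Fin 5 → ℝ) (s : ℝ) :
    HasDerivAt (devDeriv x) (-(schwarzian x / 2) * dev x s) s := by
  refine ((((hasDerivAt_oscS _ _).comp_sub_const s (x 0)).const_mul _).sub
    (((hasDerivAt_oscC _ _).comp_sub_const s (x 0)).const_mul _)).congr_deriv ?_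
  rw [dev]; ring

@[simp] theorem dev_self (x : Fin 5 → ℝ) : dev x (x 0) = 1 := by simp [dev]

@[simp] theorem devDeriv_self (x : Fin 5 → ℝ) : devDeriv x (x 0) = -(jetV x / 2) := by
  simp [devDeriv]

/-- The values of `u, u', u'' / u', S` at time `s` for the solution through the jet `x`. -/
def jetData (s : ℝ) (x : Fin 5 → ℝ) : Fin 4 → ℝ :=
  ![x 1 + x 2 * oscS (schwarzian x / 2) (s - x 0) / dev x s, x 2 / dev x s ^ 2,
    -2 * devDeriv x s / dev x s, schwarzian x]

/-- The jet at time `s` with given values of `u, u', u'' / u', S`. -/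
def jet (s : ℝ) (z : Fin 4 → ℝ) : Fin 5 → ℝ :=
  ![s, z 0, z 1, z 1 * z 2, z 1 * (z 3 + 3 / 2 * z 2 ^ 2)]

/-- The jet at time `s` of the solution through the jet `x`. -/
def evol (s : ℝ) (x : Fin 5 → ℝ) : Fin 5 → ℝ := jet s (jetData s x)

@[simp] theorem jet_apply_zero (s : ℝ) (z : Fin 4 → ℝ) : jet s z 0 = s := rfl
@[simp] theorem jet_apply_one (s : ℝ) (z : Fin 4 → ℝ) : jet s z 1 = z 0 := rfl
@[simp] theorem jet_apply_two (s : ℝ) (z : Fin 4 → ℝ) : jet s z 2 = z 1 := rfl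
@[simp] theorem jet_apply_three (s : ℝ) (z : Fin 4 → ℝ) : jet s z 3 = z 1 * z 2 := rfl
@[simp] theorem jet_apply_four (s : ℝ) (z : Fin 4 → ℝ) :
    jet s z 4 = z 1 * (z 3 + 3 / 2 * z 2 ^ 2) := rfl
@[simp] theorem evol_apply_zero (s : ℝ) (x : Fin 5 → ℝ) : evol s x 0 = s := rfl
theorem evol_apply_two (s : ℝ) (x : Fin 5 → ℝ) : evol s x 2 = x 2 / dev x s ^ 2 := rfl

theorem jetV_jet (s : ℝ) {z : Fin 4 → ℝ} (hz : z 1 ≠ 0) : jetV (jet s z) = z 2 := by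
  simp [jetV, hz]

theorem schwarzian_jet (s : ℝ) {z : Fin 4 → ℝ} (hz : z 1 ≠ 0) :
    schwarzian (jet s z) = z 3 := by
  simp [schwarzian, hz]

theorem jetData_jet (s : ℝ) {z : Fin 4 → ℝ} (hz : z 1 ≠ 0) : jetData s (jet s z) = z := by
  have h1 : dev (jet s z) s = 1 := dev_self (jet s z)
  have h2 : devDeriv (jet s z) s = -(z 2 / 2) := by
    rw [← jetV_jet s hz]; exact devDeriv_self (jet s z)
  ext i
  fin_cases i <;> simp [jetData, h1, h2, schwarzian_jet s hz]
  ring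

theorem evol_self {x : Fin 5 → ℝ} (hx : x 2 ≠ 0) : evol (x 0) x = x := by
  ext i
  fin_cases i <;> simp [evol, jetData, jet, jetV, schwarzian] <;> field_simp
  ring

theorem jetData_one_ne_zero {x : Fin 5 → ℝ} {s : ℝ} (hx : x 2 ≠ 0) (hs : dev x s ≠ 0) :
    jetData s x 1 ≠ 0 := div_ne_zero hx (pow_ne_zero 2 hs)

theorem jetV_evol {x : Fin 5 → ℝ} {s : ℝ} (hx : x 2 ≠ 0) (hs : dev x s ≠ 0) :
    jetV (evol s x) = -2 * devDeriv x s / dev x s := jetV_jet s (jetData_one_ne_zero hx hs)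

theorem schwarzian_evol {x : Fin 5 → ℝ} {s : ℝ} (hx : x 2 ≠ 0) (hs : dev x s ≠ 0) :
    schwarzian (evol s x) = schwarzian x := schwarzian_jet s (jetData_one_ne_zero hx hs)

/-- A solution of the linear equation may be restarted from its data at any time s; this is the
source of the flow property below. -/
theorem dev_eq (x : Fin 5 → ℝ) (s r : ℝ) :
    dev x r = dev x s * oscC (schwarzian x / 2) (r - s)
      + devDeriv x s * oscS (schwarzian x / 2) (r - s) := by
  have e : r - x 0 = (s - x 0) + (r - s) := by ring
  simp only [dev, devDeriv]
  rw [e, oscC_add, oscS_add]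
  ring

theorem devDeriv_eq (x : Fin 5 → ℝ) (s r : ℝ) :
    devDeriv x r = devDeriv x s * oscC (schwarzian x / 2) (r - s)
      - schwarzian x / 2 * dev x s * oscS (schwarzian x / 2) (r - s) := by
  have e : r - x 0 = (s - x 0) + (r - s) := by ring
  simp only [dev, devDeriv]
  rw [e, oscC_add, oscS_add]
  ring

/-- The two sides solve the same linear equation; the quotient restores the normalisation to 1 at
the new initial time s. -/
theorem dev_evol {x : Fin 5 → ℝ} {s : ℝ} (hx : x 2 ≠ 0) (hs : dev x s ≠ 0) (r : ℝ) :
    dev (evol s x) r = dev x r / dev x s := by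
  rw [dev_eq x s r, dev, jetV_evol hx hs, schwarzian_evol hx hs, evol_apply_zero]
  field_simp
  ring

theorem devDeriv_evol {x : Fin 5 → ℝ} {s : ℝ} (hx : x 2 ≠ 0) (hs : dev x s ≠ 0) (r : ℝ) :
    devDeriv (evol s x) r = devDeriv x r / dev x s := by
  rw [devDeriv_eq x s r, devDeriv, jetV_evol hx hs, schwarzian_evol hx hs, evol_apply_zero]
  field_simp
  ring

/-- The flow property in coordinates: the data at time r do not depend on the jet of the solution
from which they are computed. -/
theorem jetData_evol {x : Fin 5 → ℝ} {s r : ℝ} (hx : x 2 ≠ 0) (hs : dev x s ≠ 0)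
    (hr : dev x r ≠ 0) : jetData r (evol s x) = jetData r x := by
  have e : r - x 0 = (s - x 0) + (r - s) := by ring
  have h0 : jetData s x 0 = x 1 + x 2 * oscS (schwarzian x / 2) (s - x 0) / dev x s := rfl
  -- Additivity of the increments of u over [x₀, s] and [s, r], cleared of denominators.
  have key : oscS (schwarzian x / 2) (s - x 0) * dev x r + oscS (schwarzian x / 2) (r - s)
      = oscS (schwarzian x / 2) (r - x 0) * dev x s := by
    rw [dev, dev, e, oscC_add, oscS_add]
    linear_combination -oscS (schwarzian x / 2) (r - s) *
      oscC_sq_add (schwarzian x / 2) (s - x 0)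
  ext i
  fin_cases i
  · simp only [jetData, dev_evol hx hs, schwarzian_evol hx hs, evol_apply_zero, evol_apply_two]
    simp only [evol, jet_apply_one, h0, Fin.zero_eta, Matrix.cons_val_zero]
    field_simp
    linear_combination (x 2) * key
  · simp [jetData, dev_evol hx hs, evol_apply_two]
    field_simp
  · simp [jetData, dev_evol hx hs, devDeriv_evol hx hs]
    field_simp
  · simp [jetData, schwarzian_evol hx hs]

theorem evol_evol {x : Fin 5 → ℝ} {s r : ℝ} (hx : x 2 ≠ 0) (hs : dev x s ≠ 0)
    (hr : dev x r ≠ 0) : evol r (evol s x) = evol r x := by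
  rw [evol, jetData_evol hx hs hr, evol]

theorem evol_two_ne_zero {x : Fin 5 → ℝ} {s : ℝ} (hx : x 2 ≠ 0) (hs : dev x s ≠ 0) :
    evol s x 2 ≠ 0 := jetData_one_ne_zero hx hs

/-- A constant Wronskian: it says that `oscS / dev` has derivative `1 / dev ^ 2`, which is why the
formula for u integrates u'. -/
theorem wronskian_dev (x : Fin 5 → ℝ) (s : ℝ) :
    oscC (schwarzian x / 2) (s - x 0) * dev x s
      - oscS (schwarzian x / 2) (s - x 0) * devDeriv x s = 1 := by
  rw [dev, devDeriv]
  linear_combination oscC_sq_add (schwarzian x / 2) (s - x 0)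

theorem hasDerivAt_evol {x : Fin 5 → ℝ} {s : ℝ} (hx : x 2 ≠ 0) (hs : dev x s ≠ 0) :
    HasDerivAt (fun r => evol r x) (totalField eqRHS (evol s x)) s := by
  have hE := hasDerivAt_dev x s
  have hE' := hasDerivAt_devDeriv x s
  have hS := (hasDerivAt_oscS (schwarzian x / 2) (s - x 0)).comp_sub_const s (x 0)
  have hp : HasDerivAt (fun r => x 2 / dev x r ^ 2) _ s :=
    (hasDerivAt_const s (x 2)).div (hE.pow 2) (pow_ne_zero 2 hs)
  have hv : HasDerivAt (fun r => -2 * devDeriv x r / dev x r) _ s := (hE'.const_mul (-2)).div hE hs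
  rw [hasDerivAt_pi]
  intro i
  fin_cases i
  · exact hasDerivAt_id s
  · refine ((((hS.const_mul (x 2)).div hE hs)).const_add (x 1)).congr_deriv ?_
    simp [totalField, evol_apply_two]
    field_simp
    linear_combination wronskian_dev x s
  · refine hp.congr_deriv ?_
    simp [totalField, evol, jetData]
    field_simp
  · refine (hp.mul hv).congr_deriv ?_
    simp [totalField, evol, jetData]
    field_simp
    ring
  · refine (hp.mul ((hv.pow 2).const_mul (3 / 2) |>.const_add (schwarzian x))).congr_deriv ?_
    have e : totalField eqRHS (evol s x) ⟨4, by norm_num⟩ = eqRHS (evol s x) := rfl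
    rw [e, eqRHS_eq (evol_two_ne_zero hx hs), jetV_evol hx hs, schwarzian_evol hx hs]
    simp [evol_apply_two]
    field_simp
    ring

/-! ### Leaves as an explicit equivalence relation -/

/-- The solution through the jet `x` extends to the time `s`. -/
def ReachesTime (x : Fin 5 → ℝ) (s : ℝ) : Prop := ∀ θ ∈ Set.uIcc (x 0) s, 0 < dev x θ

theorem ReachesTime.dev_pos {x : Fin 5 → ℝ} {s : ℝ} (h : ReachesTime x s) : 0 < dev x s :=
  h s Set.right_mem_uIcc

theorem ReachesTime.dev_ne {x : Fin 5 → ℝ} {s : ℝ} (h : ReachesTime x s) : dev x s ≠ 0 := h.dev_pos.ne'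

theorem reachesTime_self (x : Fin 5 → ℝ) : ReachesTime x (x 0) := fun θ hθ => by
  simp at hθ
  simp [hθ]

theorem ReachesTime.mono {x : Fin 5 → ℝ} {s r : ℝ} (h : ReachesTime x s) (hr : r ∈ Set.uIcc (x 0) s) :
    ReachesTime x r := fun θ hθ => h θ (Set.uIcc_subset_uIcc_left hr hθ)

theorem ReachesTime.trans {x : Fin 5 → ℝ} {s r : ℝ} (hx : x 2 ≠ 0) (h : ReachesTime x s)
    (h' : ReachesTime (evol s x) r) : ReachesTime x r := fun θ hθ => by
  rcases Set.uIcc_subset_uIcc_union_uIcc (b := s) hθ with hθ | hθ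
  · exact h θ hθ
  · have := h' θ hθ
    rw [dev_evol hx h.dev_ne] at this
    exact (div_pos_iff_of_pos_right h.dev_pos).1 this

theorem ReachesTime.symm {x : Fin 5 → ℝ} {s : ℝ} (hx : x 2 ≠ 0) (h : ReachesTime x s) :
    ReachesTime (evol s x) (x 0) := fun θ hθ => by
  rw [evol_apply_zero, Set.uIcc_comm] at hθ
  rw [dev_evol hx h.dev_ne]
  exact div_pos (h θ hθ) h.dev_pos

theorem evol_symm {x : Fin 5 → ℝ} {s : ℝ} (hx : x 2 ≠ 0) (h : ReachesTime x s) :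
    evol (x 0) (evol s x) = x := by
  rw [evol_evol hx h.dev_ne (reachesTime_self x).dev_ne, evol_self hx]

/-- Two jets lie on the graph of the 3-jets of one solution. -/
def SameLeaf (x y : jetSpace) : Prop :=
  ReachesTime (x : Fin 5 → ℝ) ((y : Fin 5 → ℝ) 0) ∧
    (y : Fin 5 → ℝ) = evol ((y : Fin 5 → ℝ) 0) (x : Fin 5 → ℝ)

theorem sameLeaf_equivalence : Equivalence SameLeaf where
  refl x := ⟨reachesTime_self _, (evol_self x.2).symm⟩
  symm := by
    rintro ⟨x, hx⟩ ⟨y, hy⟩ ⟨h, e⟩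
    simp only at h e
    constructor
    · simp only
      rw [e]
      exact h.symm hx
    · simp only
      conv_rhs => rw [e]
      exact (evol_symm hx h).symm
  trans := by
    rintro ⟨x, hx⟩ ⟨y, hy⟩ ⟨z, hz⟩ ⟨h, e⟩ ⟨h', e'⟩
    simp only at h e h' e'
    rw [e] at h' e'
    have H := h.trans hx h'
    refine ⟨H, ?_⟩
    rw [evol_evol hx h.dev_ne H.dev_ne] at e'
    exact e'

/-! ### Uniqueness of integral curves and equality in the quotient -/

theorem eq_of_hasDerivWithinAt_zero {f : ℝ → ℝ} {a b : ℝ}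
    (hf : ∀ τ ∈ Set.Icc a b, HasDerivWithinAt f 0 (Set.Icc a b) τ) :
    ∀ τ ∈ Set.Icc a b, f τ = f a := by
  intro τ hτ
  rcases hτ.1.eq_or_lt with rfl | hlt
  · rfl
  have hab : a < b := hlt.trans_le hτ.2
  exact constant_of_derivWithin_zero (fun τ hτ => (hf τ hτ).differentiableWithinAt)
    (fun τ hτ => (hf τ (Set.Ico_subset_Icc_self hτ)).derivWithin
      (uniqueDiffOn_Icc hab τ (Set.Ico_subset_Icc_self hτ))) τ hτ

/-- Uniqueness by first integrals, with no general ODE theorem: comparison with the explicit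
solution gives enough functions that are constant along γ to determine it. -/
theorem eq_evol_of_integralCurve {γ : ℝ → (Fin 5 → ℝ)} {a b : ℝ}
    (hγ : ∀ τ ∈ Set.Icc a b, γ τ ∈ jetSpace ∧
      HasDerivWithinAt γ (totalField eqRHS (γ τ)) (Set.Icc a b) τ) :
    ∀ τ ∈ Set.Icc a b, γ τ 0 = γ a 0 + (τ - a) ∧ dev (γ a) (γ τ 0) ≠ 0 ∧
      γ τ = evol (γ τ 0) (γ a) := by
  set I := Set.Icc a b with hI
  intro τ₁ hτ₁
  have ha : a ∈ I := ⟨le_rfl, hτ₁.1.trans hτ₁.2⟩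
  have hp0 : ∀ τ ∈ I, γ τ 2 ≠ 0 := fun τ hτ => (hγ τ hτ).1
  have hd : ∀ i, ∀ τ ∈ I,
      HasDerivWithinAt (fun τ => γ τ i) (totalField eqRHS (γ τ) i) I τ := fun i τ hτ =>
    hasDerivWithinAt_pi.1 (hγ τ hτ).2 i
  have ht : ∀ τ ∈ I, γ τ 0 = γ a 0 + (τ - a) := fun τ hτ => by
    have : γ τ 0 - τ = γ a 0 - a := eq_of_hasDerivWithinAt_zero (f := fun τ => γ τ 0 - τ) (a := a) (b := b)
      (fun τ hτ => ((hd 0 τ hτ).sub (hasDerivWithinAt_id τ I)).congr_deriv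
        (by simp [totalField])) τ hτ
    linarith
  have hS : ∀ τ ∈ I, schwarzian (γ τ) = schwarzian (γ a) :=
    eq_of_hasDerivWithinAt_zero fun τ hτ => by
      have h1 := ((contDiffAt_schwarzian (hp0 τ hτ)).differentiableAt (by simp)).hasFDerivAt
      have h2 := h1.comp_hasDerivWithinAt τ (hγ τ hτ).2
      rwa [fderiv_schwarzian_totalField (hp0 τ hτ)] at h2
  have hv : ∀ τ ∈ I, HasDerivWithinAt (fun τ => jetV (γ τ))
      (schwarzian (γ a) + jetV (γ τ) ^ 2 / 2) I τ := fun τ hτ => by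
    have h1 := ((contDiffAt_jetV (hp0 τ hτ)).differentiableAt (by simp)).hasFDerivAt
    have h2 := h1.comp_hasDerivWithinAt τ (hγ τ hτ).2
    rwa [fderiv_jetV_totalField (hp0 τ hτ), hS τ hτ] at h2
  have hp : ∀ τ ∈ I, HasDerivWithinAt (fun τ => γ τ 2) (γ τ 2 * jetV (γ τ)) I τ := fun τ hτ =>
    (hd 2 τ hτ).congr_deriv (by
      have := hp0 τ hτ
      simp only [totalField, jetV]
      field_simp
      rfl)
  have ht' : ∀ τ ∈ I, HasDerivWithinAt (fun τ => γ τ 0) 1 I τ := hd 0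
  have hE : ∀ τ ∈ I, HasDerivWithinAt (fun τ => dev (γ a) (γ τ 0)) (devDeriv (γ a) (γ τ 0)) I τ :=
    fun τ hτ => by
      simpa only [mul_one] using! (hasDerivAt_dev (γ a) (γ τ 0)).comp_hasDerivWithinAt τ (ht' τ hτ)
  have hE' : ∀ τ ∈ I, HasDerivWithinAt (fun τ => devDeriv (γ a) (γ τ 0))
      (-(schwarzian (γ a) / 2) * dev (γ a) (γ τ 0)) I τ := fun τ hτ => by
    simpa only [mul_one] using!
      (hasDerivAt_devDeriv (γ a) (γ τ 0)).comp_hasDerivWithinAt τ (ht' τ hτ)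
  -- The defect m = vE + 2E' satisfies m' = (v/2)m, while p' = vp. So m²/p is constant, and m = 0 at
  -- a because E = 1 and E' = -v/2 there. This avoids dividing by E, not yet known to be nonzero.
  have hm : ∀ τ ∈ I, jetV (γ τ) * dev (γ a) (γ τ 0) + 2 * devDeriv (γ a) (γ τ 0) = 0 :=
    fun τ hτ => by
      have h := eq_of_hasDerivWithinAt_zero (a := a) (b := b)
        (f := fun τ => (jetV (γ τ) * dev (γ a) (γ τ 0) + 2 * devDeriv (γ a) (γ τ 0)) ^ 2 / γ τ 2)
        (fun τ hτ => (((((hv τ hτ).mul (hE τ hτ)).add ((hE' τ hτ).const_mul 2)).pow 2).div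
          (hp τ hτ) (hp0 τ hτ)).congr_deriv (by
            simp only [Pi.add_apply, Pi.mul_apply, Pi.pow_apply]
            rw [div_eq_zero_iff]
            left
            push_cast
            ring)) τ hτ
      simp at h
      have e : jetV (γ a) + -(2 * (jetV (γ a) / 2)) = 0 := by ring
      simpa [e, hp0 τ hτ] using h
  have hpE : ∀ τ ∈ I, γ τ 2 * dev (γ a) (γ τ 0) ^ 2 = γ a 2 := fun τ hτ => by
    have h := eq_of_hasDerivWithinAt_zero (a := a) (b := b)
      (f := fun τ => γ τ 2 * dev (γ a) (γ τ 0) ^ 2)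
      (fun τ hτ => ((hp τ hτ).mul ((hE τ hτ).pow 2)).congr_deriv (by
        simp
        linear_combination (γ τ 2 * dev (γ a) (γ τ 0)) * hm τ hτ)) τ hτ
    simpa using h
  -- A zero of E would contradict pE² = p(a) ≠ 0.
  have hE0 : ∀ τ ∈ I, dev (γ a) (γ τ 0) ≠ 0 := fun τ hτ h0 => by
    have := hpE τ hτ
    rw [h0] at this
    exact hp0 a ha (by simpa using this.symm)
  have hu : ∀ τ ∈ I, γ τ 1 - γ a 2 * oscS (schwarzian (γ a) / 2) (γ τ 0 - γ a 0)
      / dev (γ a) (γ τ 0) = γ a 1 := fun τ hτ => by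
    have hs : ∀ τ ∈ I, HasDerivWithinAt
        (fun τ => oscS (schwarzian (γ a) / 2) (γ τ 0 - γ a 0))
        (oscC (schwarzian (γ a) / 2) (γ τ 0 - γ a 0)) I τ := fun τ hτ => by
      simpa only [mul_one] using! ((hasDerivAt_oscS (schwarzian (γ a) / 2)
        (γ τ 0 - γ a 0)).comp_sub_const (γ τ 0) (γ a 0)).comp_hasDerivWithinAt τ (ht' τ hτ)
    have h := eq_of_hasDerivWithinAt_zero (a := a) (b := b)
      (f := fun τ => γ τ 1 - γ a 2 * oscS (schwarzian (γ a) / 2) (γ τ 0 - γ a 0)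
        / dev (γ a) (γ τ 0))
      (fun τ hτ => ((hd 1 τ hτ).sub (((hs τ hτ).const_mul (γ a 2)).div (hE τ hτ)
        (hE0 τ hτ))).congr_deriv (by
          have e1 : totalField eqRHS (γ τ) 1 = γ τ 2 := rfl
          have := hE0 τ hτ
          rw [e1]
          field_simp
          linear_combination hpE τ hτ - γ a 2 * wronskian_dev (γ a) (γ τ 0))) τ hτ
    simpa using h
  have hx := hp0 τ₁ hτ₁
  have hE1 := hE0 τ₁ hτ₁
  have e2 : jetData (γ τ₁ 0) (γ a) 1 = γ τ₁ 2 := by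
    simp only [jetData, Matrix.cons_val_one, Matrix.cons_val_zero]
    rw [← hpE τ₁ hτ₁]; field_simp
  have e3 : jetData (γ τ₁ 0) (γ a) 2 = jetV (γ τ₁) := by
    have : jetData (γ τ₁ 0) (γ a) 2 = -2 * devDeriv (γ a) (γ τ₁ 0) / dev (γ a) (γ τ₁ 0) := rfl
    rw [this, div_eq_iff hE1]
    linear_combination -hm τ₁ hτ₁
  have e4 : jetData (γ τ₁ 0) (γ a) 3 = schwarzian (γ τ₁) := (hS τ₁ hτ₁).symm
  refine ⟨ht τ₁ hτ₁, hE1, ?_⟩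
  ext i
  fin_cases i
  · rfl
  · simp [evol, jetData]
    linarith [hu τ₁ hτ₁]
  · exact e2.symm
  · simp only [evol, jet_apply_three, e2, e3, jetV, Fin.reduceFinMk]
    field_simp
  · simp only [evol, jet_apply_four, e2, e3, e4, jetV, schwarzian, Fin.reduceFinMk]
    field_simp
    ring

theorem SameLeaf.of_flowsTo {x y : jetSpace} (h : flowsTo x y) : SameLeaf x y := by
  obtain ⟨γ, a, b, hab, hγ, ha, hb⟩ := h
  have key := eq_evol_of_integralCurve hγ
  rw [ha] at key
  have hb' := key b ⟨hab, le_rfl⟩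
  rw [hb] at hb'
  refine ⟨fun θ hθ => ?_, hb'.2.2⟩
  rw [hb'.1, Set.uIcc_of_le (by linarith)] at hθ
  have hne : ∀ r ∈ Set.Icc ((x : Fin 5 → ℝ) 0) θ, dev x r ≠ 0 := fun r hr => by
    have hm : a + (r - (x : Fin 5 → ℝ) 0) ∈ Set.Icc a b :=
      ⟨by linarith [hr.1], by linarith [hr.2, hθ.2]⟩
    have := key _ hm
    rw [this.1] at this
    simpa using this.2.1
  -- E equals 1 at the start and has no zero up to θ, so it stays positive by the intermediate value
  -- theorem.
  by_contra! hle
  have hc : ContinuousOn (dev x) (Set.Icc ((x : Fin 5 → ℝ) 0) θ) := fun r _ =>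
    (hasDerivAt_dev x r).continuousAt.continuousWithinAt
  obtain ⟨r, hr, h0⟩ := intermediate_value_Icc' hθ.1 hc ⟨hle, by simp⟩
  exact hne r hr h0

theorem SameLeaf.flowsTo_of_le {x y : jetSpace} (h : SameLeaf x y)
    (hle : (x : Fin 5 → ℝ) 0 ≤ (y : Fin 5 → ℝ) 0) : flowsTo x y := by
  refine ⟨fun r => evol r x, (x : Fin 5 → ℝ) 0, (y : Fin 5 → ℝ) 0, hle, fun τ hτ => ?_,
    evol_self x.2, h.2.symm⟩
  have h0 := (h.1 τ (by rwa [Set.uIcc_of_le hle])).ne'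
  exact ⟨evol_two_ne_zero x.2 h0, (hasDerivAt_evol x.2 h0).hasDerivWithinAt⟩

/-- `flowsTo` only goes forward in time, so the quotient is by the equivalence it generates.
`SameLeaf` is an equivalence containing it, and related jets flow one to the other in the order of
their times. -/
theorem toSolution_eq_iff {x y : jetSpace} : toSolution x = toSolution y ↔ SameLeaf x y := by
  constructor
  · intro h
    exact sameLeaf_equivalence.eqvGen_iff.1
      (Relation.EqvGen.mono (fun _ _ => SameLeaf.of_flowsTo) x y (Quot.eqvGen_exact h))
  · intro h
    rcases le_total ((x : Fin 5 → ℝ) 0) ((y : Fin 5 → ℝ) 0) with hle | hle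
    · exact Quot.sound (h.flowsTo_of_le hle)
    · exact (Quot.sound ((sameLeaf_equivalence.symm h).flowsTo_of_le hle)).symm

/-! ### Smooth dependence on the jet and openness of the domains -/

theorem contDiffAt_dev_uncurry {z : (Fin 5 → ℝ) × ℝ} (hz : z.1 2 ≠ 0) :
    ContDiffAt ℝ ∞ (fun z : (Fin 5 → ℝ) × ℝ => dev z.1 z.2) z := by
  have hS : ContDiffAt ℝ ∞ (fun z : (Fin 5 → ℝ) × ℝ => schwarzian z.1 / 2) z :=
    ((contDiffAt_schwarzian hz).comp z contDiffAt_fst).div_const 2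
  have hv : ContDiffAt ℝ ∞ (fun z : (Fin 5 → ℝ) × ℝ => jetV z.1 / 2) z :=
    ((contDiffAt_jetV hz).comp z contDiffAt_fst).div_const 2
  have ht : ContDiffAt ℝ ∞ (fun z : (Fin 5 → ℝ) × ℝ => z.2 - z.1 0) z :=
    contDiffAt_snd.sub ((contDiffAt_apply ℝ ℝ 0 z.1).comp z contDiffAt_fst)
  exact (contDiff_oscC.contDiffAt.comp z (hS.prodMk ht)).sub
    (hv.mul (contDiff_oscS.contDiffAt.comp z (hS.prodMk ht)))

theorem contDiffAt_sub_apply_zero (s : ℝ) (x : Fin 5 → ℝ) :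
    ContDiffAt ℝ ∞ (fun x : Fin 5 → ℝ => s - x 0) x :=
  contDiffAt_const.sub (contDiffAt_apply ℝ ℝ 0 x)

theorem contDiffAt_dev {x : Fin 5 → ℝ} (s : ℝ) (hx : x 2 ≠ 0) :
    ContDiffAt ℝ ∞ (fun x => dev x s) x :=
  (contDiffAt_dev_uncurry (z := (x, s)) hx).comp x (contDiffAt_id.prodMk contDiffAt_const)

theorem contDiffAt_devDeriv {x : Fin 5 → ℝ} (s : ℝ) (hx : x 2 ≠ 0) :
    ContDiffAt ℝ ∞ (fun x => devDeriv x s) x := by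
  have hS := (contDiffAt_schwarzian hx).div_const 2
  have ht := contDiffAt_sub_apply_zero s x
  exact (hS.neg.mul (contDiff_oscS.contDiffAt.comp x (hS.prodMk ht))).sub
    (((contDiffAt_jetV hx).div_const 2).mul (contDiff_oscC.contDiffAt.comp x (hS.prodMk ht)))

theorem contDiffAt_jetData {x : Fin 5 → ℝ} {s : ℝ} (hx : x 2 ≠ 0) (hs : dev x s ≠ 0) :
    ContDiffAt ℝ ∞ (jetData s) x := by
  have hS := (contDiffAt_schwarzian hx).div_const 2
  have ht := contDiffAt_sub_apply_zero s x
  have hE := contDiffAt_dev s hx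
  rw [contDiffAt_pi]
  intro i
  fin_cases i
  · exact (contDiffAt_apply ℝ ℝ 1 x).add (((contDiffAt_apply ℝ ℝ 2 x).mul
      (contDiff_oscS.contDiffAt.comp x (hS.prodMk ht))).div hE hs)
  · exact (contDiffAt_apply ℝ ℝ 2 x).div (hE.pow 2) (pow_ne_zero 2 hs)
  · exact (contDiffAt_const.mul (contDiffAt_devDeriv s hx)).div hE hs
  · exact contDiffAt_schwarzian hx

theorem contDiff_jet (s : ℝ) : ContDiff ℝ ∞ (jet s) := by
  rw [contDiff_pi]
  have h0 := contDiff_apply ℝ ℝ (n := ∞) (0 : Fin 4)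
  have h1 := contDiff_apply ℝ ℝ (n := ∞) (1 : Fin 4)
  have h2 := contDiff_apply ℝ ℝ (n := ∞) (2 : Fin 4)
  have h3 := contDiff_apply ℝ ℝ (n := ∞) (3 : Fin 4)
  intro i
  fin_cases i
  · exact contDiff_const
  · exact h0
  · exact h1
  · exact h1.mul h2
  · exact h1.mul (h3.add (contDiff_const.mul (h2.pow 2)))

/-- Rescales the moving interval to the fixed compact [0, 1], so that a tube argument gives openness
in (x, s). -/
theorem reachesTime_iff {x : Fin 5 → ℝ} {s : ℝ} :
    ReachesTime x s ↔ ∀ θ ∈ Set.Icc (0 : ℝ) 1, 0 < dev x (x 0 + θ * (s - x 0)) := by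
  rw [ReachesTime, ← segment_eq_uIcc, segment_eq_image']
  exact Set.forall_mem_image

theorem ReachesTime.eventually {x : Fin 5 → ℝ} {s : ℝ} (hx : x 2 ≠ 0) (h : ReachesTime x s) :
    ∀ᶠ w : (Fin 5 → ℝ) × ℝ in nhds (x, s), ReachesTime w.1 w.2 := by
  simp only [reachesTime_iff]
  refine isCompact_Icc.eventually_forall_of_forall_eventually fun θ hθ => ?_
  have hg : ContinuousAt (fun z : ((Fin 5 → ℝ) × ℝ) × ℝ =>
      (z.1.1, z.1.1 0 + z.2 * (z.1.2 - z.1.1 0))) ((x, s), θ) :=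
    Continuous.continuousAt (by fun_prop)
  have hc : ContinuousAt (fun z : ((Fin 5 → ℝ) × ℝ) × ℝ =>
      dev z.1.1 (z.1.1 0 + z.2 * (z.1.2 - z.1.1 0))) ((x, s), θ) :=
    (contDiffAt_dev_uncurry (z := (x, x 0 + θ * (s - x 0))) hx).continuousAt.comp_of_eq hg rfl
  exact hc.eventually (lt_mem_nhds (reachesTime_iff.1 h θ hθ))

theorem ReachesTime.eventually_left {x : Fin 5 → ℝ} {s : ℝ} (hx : x 2 ≠ 0)
    (h : ReachesTime x s) : ∀ᶠ y in nhds x, ReachesTime y s :=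
  (Continuous.tendsto (by fun_prop : Continuous fun y : Fin 5 → ℝ => (y, s)) x).eventually
    (h.eventually hx)

theorem SameLeaf.reachesTime {x y : jetSpace} (h : SameLeaf x y) {s : ℝ}
    (hs : ReachesTime x s) : ReachesTime y s := by
  obtain ⟨h1, h2⟩ := sameLeaf_equivalence.symm h
  exact h1.trans y.2 (h2 ▸ hs)

theorem SameLeaf.jetData_eq {x y : jetSpace} (h : SameLeaf x y) {s : ℝ}
    (hs : ReachesTime x s) : jetData s y = jetData s x := by
  rw [h.2, jetData_evol x.2 h.1.dev_ne hs.dev_ne]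

/-! ### Charts of the solution space -/

/-- A jet on the integral curve that a solution stands for. -/
def SolutionSpace.rep (m : SolutionSpace) : jetSpace := Quot.out m

@[simp] theorem toSolution_rep (m : SolutionSpace) : toSolution m.rep = m := Quot.out_eq m

theorem sameLeaf_rep (x : jetSpace) : SameLeaf (toSolution x).rep x :=
  toSolution_eq_iff.1 (toSolution_rep _)

theorem reachesTime_rep_iff {x : jetSpace} {s : ℝ} :
    ReachesTime (toSolution x).rep s ↔ ReachesTime x s :=
  ⟨(sameLeaf_rep x).reachesTime, (sameLeaf_equivalence.symm (sameLeaf_rep x)).reachesTime⟩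

theorem jetData_rep {x : jetSpace} {s : ℝ} (hs : ReachesTime x s) :
    jetData s (toSolution x).rep = jetData s x :=
  (sameLeaf_equivalence.symm (sameLeaf_rep x)).jetData_eq hs

/-- The map `jet s`, corrected where its value is not in `jetSpace`. -/
def jetOn (s : ℝ) (z : Fin 4 → ℝ) : jetSpace :=
  if h : z 1 ≠ 0 then ⟨jet s z, h⟩ else ⟨jet s 1, one_ne_zero⟩

theorem coe_jetOn (s : ℝ) {z : Fin 4 → ℝ} (hz : z 1 ≠ 0) : (jetOn s z : Fin 5 → ℝ) = jet s z := by
  rw [jetOn, dif_pos hz]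

theorem reachesTime_jetOn (s : ℝ) {z : Fin 4 → ℝ} (hz : z 1 ≠ 0) : ReachesTime (jetOn s z) s := by
  rw [coe_jetOn s hz]
  exact reachesTime_self (jet s z)

theorem toSolution_jetOn_jetData {x : jetSpace} {s : ℝ} (hs : ReachesTime x s) :
    toSolution (jetOn s (jetData s x)) = toSolution x := by
  have h1 := jetData_one_ne_zero x.2 hs.dev_ne
  refine (toSolution_eq_iff.2 ⟨?_, ?_⟩).symm
  · rw [coe_jetOn s h1]
    exact hs
  · rw [coe_jetOn s h1]
    rfl

theorem isQuotientMap_toSolution : Topology.IsQuotientMap toSolution := isQuotientMap_quot_mk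

theorem isOpen_setOf_ne_zero : IsOpen {z : Fin 4 → ℝ | z 1 ≠ 0} :=
  isOpen_ne_fun (continuous_apply 1) continuous_const

theorem continuousOn_jetOn (s : ℝ) : ContinuousOn (jetOn s) {z | z 1 ≠ 0} := by
  rw [Topology.IsInducing.subtypeVal.continuousOn_iff]
  exact (contDiff_jet s).continuous.continuousOn.congr fun z hz => coe_jetOn s hz

theorem isOpen_setOf_reachesTime_rep (s : ℝ) :
    IsOpen {m : SolutionSpace | ReachesTime m.rep s} := by
  rw [← isQuotientMap_toSolution.isOpen_preimage, isOpen_iff_mem_nhds]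
  intro x hx
  have h := ReachesTime.eventually_left x.2 (reachesTime_rep_iff.1 hx)
  have h' := continuousAt_subtype_val.eventually h
  filter_upwards [h'] with y hy using reachesTime_rep_iff.2 hy

/-- The chart of the solution space given by the values of `u, u', u'' / u', S` at time `s`. -/
def timeChart (s : ℝ) : OpenPartialHomeomorph SolutionSpace (Fin 4 → ℝ) where
  toFun m := jetData s m.rep
  invFun z := toSolution (jetOn s z)
  source := {m | ReachesTime m.rep s}
  target := {z | z 1 ≠ 0}
  map_source' m hm := jetData_one_ne_zero m.rep.2 (ReachesTime.dev_ne hm)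
  map_target' _ hz := reachesTime_rep_iff.2 (reachesTime_jetOn s hz)
  left_inv' m hm := (toSolution_jetOn_jetData hm).trans (toSolution_rep m)
  right_inv' z hz := by
    rw [jetData_rep (reachesTime_jetOn s hz), coe_jetOn s hz, jetData_jet s hz]
  open_source := isOpen_setOf_reachesTime_rep s
  open_target := isOpen_setOf_ne_zero
  continuousOn_toFun := by
    rw [isQuotientMap_toSolution.continuousOn_isOpen_iff (isOpen_setOf_reachesTime_rep s)]
    intro x hx
    have hx' : ReachesTime x s := reachesTime_rep_iff.1 hx
    have h : ContinuousAt (fun x : jetSpace => jetData s x) x :=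
      (contDiffAt_jetData x.2 hx'.dev_ne).continuousAt.comp continuousAt_subtype_val
    exact h.continuousWithinAt.congr (fun y hy => jetData_rep (reachesTime_rep_iff.1 hy))
      (jetData_rep hx')
  continuousOn_invFun := isQuotientMap_toSolution.continuous.comp_continuousOn
    (continuousOn_jetOn s)

/-- The atlas of all charts `timeChart s`. -/
@[reducible]
def solutionChartedSpace : ChartedSpace (Fin 4 → ℝ) SolutionSpace where
  atlas := Set.range timeChart
  chartAt m := timeChart ((m.rep : Fin 5 → ℝ) 0)
  mem_chart_source _ := reachesTime_self _
  chart_mem_atlas _ := ⟨_, rfl⟩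

/-- A change of charts is the flow from time s to time r: rebuild the jet at s, then read the data
at r. -/
theorem contDiffOn_timeChart_trans (s r : ℝ) :
    ContDiffOn ℝ ∞ ((timeChart s).symm ≫ₕ timeChart r) ((timeChart s).symm ≫ₕ timeChart r).source := by
  rintro z ⟨hz, hz'⟩
  have hz1 : z 1 ≠ 0 := hz
  have hr : ReachesTime (jet s z) r := by
    have : ReachesTime (toSolution (jetOn s z)).rep r := hz'
    rwa [reachesTime_rep_iff, coe_jetOn s hz1] at this
  have h : ContDiffAt ℝ ∞ (fun z => jetData r (jet s z)) z :=
    (contDiffAt_jetData hz1 hr.dev_ne).comp z (contDiff_jet s).contDiffAt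
  refine h.contDiffWithinAt.congr (fun w hw => ?_) ?_
  · have hw1 : w 1 ≠ 0 := hw.1
    have : ReachesTime (toSolution (jetOn s w)).rep r := hw.2
    change jetData r (toSolution (jetOn s w)).rep = _
    rw [jetData_rep (reachesTime_rep_iff.1 this), coe_jetOn s hw1]
  · have : ReachesTime (toSolution (jetOn s z)).rep r := hz'
    change jetData r (toSolution (jetOn s z)).rep = _
    rw [jetData_rep (reachesTime_rep_iff.1 this), coe_jetOn s hz1]

theorem isManifold_solutionChartedSpace :
    @IsManifold ℝ _ (Fin 4 → ℝ) _ _ (Fin 4 → ℝ) _ 𝓘(ℝ, Fin 4 → ℝ) ∞ SolutionSpace _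
      solutionChartedSpace := by
  let := solutionChartedSpace
  refine isManifold_of_contDiffOn _ _ _ ?_
  rintro _ _ ⟨s, rfl⟩ ⟨r, rfl⟩
  simpa using contDiffOn_timeChart_trans s r

/-! ### The differential of the quotient map -/

theorem hasMFDerivAt_subtype_val (x : jetSpace) :
    HasMFDerivAt 𝓘(ℝ, Fin 5 → ℝ) 𝓘(ℝ, Fin 5 → ℝ) (Subtype.val : jetSpace → Fin 5 → ℝ) x
      (ContinuousLinearMap.id ℝ (Fin 5 → ℝ)) := by
  refine ⟨continuousAt_subtype_val, ?_⟩
  have h : writtenInExtChartAt 𝓘(ℝ, Fin 5 → ℝ) 𝓘(ℝ, Fin 5 → ℝ) x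
      (Subtype.val : jetSpace → Fin 5 → ℝ) =ᶠ[nhds (x : Fin 5 → ℝ)] id := by
    have hx : (x : Fin 5 → ℝ) ∈ (chartAt (Fin 5 → ℝ) x).target := mem_chart_target _ x
    filter_upwards [(chartAt (Fin 5 → ℝ) x).open_target.mem_nhds hx] with y hy
    exact (OpenPartialHomeomorph.refl (Fin 5 → ℝ)).subtypeRestr_symm_apply ⟨x⟩ hy
  exact ((hasFDerivAt_id _).congr_of_eventuallyEq h).hasFDerivWithinAt

open scoped Classical in
/-- The quotient map, extended to all jets by a constant. -/
def toSolutionExt (x : Fin 5 → ℝ) : SolutionSpace :=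
  toSolution (if h : x ∈ jetSpace then ⟨x, h⟩ else jetOn 0 1)

theorem toSolutionExt_coe (x : jetSpace) : toSolutionExt x = toSolution x := by
  rw [toSolutionExt, dif_pos x.2]

theorem toSolutionExt_eq_iff {x y : Fin 5 → ℝ} (hx : x 2 ≠ 0) (hy : y 2 ≠ 0) :
    toSolutionExt x = toSolutionExt y ↔ ReachesTime x (y 0) ∧ y = evol (y 0) x := by
  rw [toSolutionExt_coe ⟨x, hx⟩, toSolutionExt_coe ⟨y, hy⟩, toSolution_eq_iff, SameLeaf]

theorem toSolutionExt_evol {x : Fin 5 → ℝ} {s : ℝ} (hx : x 2 ≠ 0) (hs : ReachesTime x s) :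
    toSolutionExt (evol s x) = toSolutionExt x :=
  ((toSolutionExt_eq_iff hx (evol_two_ne_zero hx hs.dev_ne)).2 ⟨hs, rfl⟩).symm

section structures
variable [M : ChartedSpace (Fin 4 → ℝ) SolutionSpace]

/-- The differential of the quotient map, in the coordinates of a chart. -/
def quotDeriv (x : jetSpace) : (Fin 5 → ℝ) →L[ℝ] (Fin 4 → ℝ) := dToSolution x

/-- As the jet domain is open, extending π by a constant does not change its differential there; the
extension can be composed with curves and maps in ℝ⁵ directly. -/
theorem hasMFDerivAt_toSolutionExt
    (hM : ContMDiff 𝓘(ℝ, Fin 5 → ℝ) 𝓘(ℝ, Fin 4 → ℝ) ∞ toSolution) (x : jetSpace) :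
    HasMFDerivAt 𝓘(ℝ, Fin 5 → ℝ) 𝓘(ℝ, Fin 4 → ℝ) toSolutionExt (x : Fin 5 → ℝ)
      (quotDeriv x) := by
  have e : (fun x : jetSpace => toSolutionExt x) = toSolution := funext toSolutionExt_coe
  have h1 : ContMDiffAt 𝓘(ℝ, Fin 5 → ℝ) 𝓘(ℝ, Fin 4 → ℝ) ∞ toSolutionExt (x : Fin 5 → ℝ) := by
    rw [← contMDiffAt_subtype_iff, e]
    exact hM x
  have h2 := (h1.mdifferentiableAt (by simp)).hasMFDerivAt
  have h3 := HasMFDerivAt.comp x h2 (hasMFDerivAt_subtype_val x)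
  have h4 := h3.congr_of_eventuallyEq (f₁ := toSolution)
    (Filter.Eventually.of_forall fun y => (toSolutionExt_coe y).symm)
  have h5 : quotDeriv x = mfderiv 𝓘(ℝ, Fin 5 → ℝ) 𝓘(ℝ, Fin 4 → ℝ) toSolutionExt (x : Fin 5 → ℝ) :=
    h4.mfderiv
  rw [h5]
  exact h2

theorem quotDeriv_totalField
    (hM : ContMDiff 𝓘(ℝ, Fin 5 → ℝ) 𝓘(ℝ, Fin 4 → ℝ) ∞ toSolution) (x : jetSpace) :
    quotDeriv x (totalField eqRHS x) = 0 := by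
  have h0 := evol_self x.2
  have h1 := hasDerivAt_evol x.2 (reachesTime_self x).dev_ne
  rw [h0] at h1
  have h2 := hasMFDerivAt_toSolutionExt hM x
  rw [← h0] at h2
  have h3 := HasMFDerivAt.comp (f := fun r => evol r (x : Fin 5 → ℝ)) _ h2
    h1.hasFDerivAt.hasMFDerivAt
  have h4 : (toSolutionExt ∘ fun r => evol r (x : Fin 5 → ℝ))
      =ᶠ[nhds ((x : Fin 5 → ℝ) 0)] fun _ => toSolutionExt x := by
    have := (reachesTime_self (x : Fin 5 → ℝ)).eventually x.2
    have := (Continuous.tendsto (by fun_prop : Continuous fun s : ℝ => ((x : Fin 5 → ℝ), s))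
      ((x : Fin 5 → ℝ) 0)).eventually this
    filter_upwards [this] with s hs using toSolutionExt_evol x.2 hs
  have h5 := (hasMFDerivAt_const (I := 𝓘(ℝ, ℝ)) (I' := 𝓘(ℝ, Fin 4 → ℝ))
    (toSolutionExt (x : Fin 5 → ℝ)) ((x : Fin 5 → ℝ) 0)).congr_of_eventuallyEq h4
  have h6 := hasMFDerivAt_unique h3 h5
  have h7 : quotDeriv x (ContinuousLinearMap.toSpanSingleton ℝ (totalField eqRHS x) 1) = 0 :=
    congrArg (fun L : ℝ →L[ℝ] (Fin 4 → ℝ) => L 1) h6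
  simpa using h7

/-- Sliding nearby jets along their leaves to a fixed time does not change their class: the chain
rule is applied to π ∘ `evol s` = π near x. -/
theorem quotDeriv_evol
    (hM : ContMDiff 𝓘(ℝ, Fin 5 → ℝ) 𝓘(ℝ, Fin 4 → ℝ) ∞ toSolution) {x y : jetSpace}
    (h : SameLeaf x y) (ξ : Fin 5 → ℝ) :
    quotDeriv y (fderiv ℝ (evol ((y : Fin 5 → ℝ) 0)) x ξ) = quotDeriv x ξ := by
  obtain ⟨hs, he⟩ := h
  set s := (y : Fin 5 → ℝ) 0
  have h1 : HasFDerivAt (evol s) (fderiv ℝ (evol s) x) (x : Fin 5 → ℝ) :=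
    (((contDiff_jet s).contDiffAt.comp _ (contDiffAt_jetData x.2 hs.dev_ne)).differentiableAt
      (by simp)).hasFDerivAt
  have h2 := hasMFDerivAt_toSolutionExt hM y
  rw [he] at h2
  have h3 := HasMFDerivAt.comp _ h2 h1.hasMFDerivAt
  have h4 : (toSolutionExt ∘ evol s) =ᶠ[nhds (x : Fin 5 → ℝ)] toSolutionExt := by
    filter_upwards [hs.eventually_left x.2, jetSpace_mem_nhds x.2] with z hz hz2
      using toSolutionExt_evol hz2 hz
  have h5 := (hasMFDerivAt_toSolutionExt hM x).congr_of_eventuallyEq h4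
  have h6 := hasMFDerivAt_unique h3 h5
  exact congrArg (fun L : (Fin 5 → ℝ) →L[ℝ] (Fin 4 → ℝ) => L ξ) h6

end structures

/-- Differentiates `jetData s ∘ jet s = id`; the resulting right inverse makes the differential of
the data onto. -/
theorem fderiv_jetData_jet (s : ℝ) {z : Fin 4 → ℝ} (hz : z 1 ≠ 0) (w : Fin 4 → ℝ) :
    fderiv ℝ (jetData s) (jet s z) (fderiv ℝ (jet s) z w) = w := by
  have h1 : HasFDerivAt (jetData s) _ (jet s z) :=
    ((contDiffAt_jetData (x := jet s z) hz (reachesTime_self (jet s z)).dev_ne).differentiableAt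
      (by simp)).hasFDerivAt
  have h2 := h1.comp z ((contDiff_jet s).differentiable (by simp) z).hasFDerivAt
  have h3 : jetData s ∘ jet s =ᶠ[nhds z] id := by
    filter_upwards [isOpen_setOf_ne_zero.mem_nhds hz] with y hy using jetData_jet s hy
  have h4 := h2.unique ((hasFDerivAt_id z).congr_of_eventuallyEq h3)
  exact congrArg (fun L : (Fin 4 → ℝ) →L[ℝ] (Fin 4 → ℝ) => L w) h4

theorem fderiv_jetData_surjective {x : Fin 5 → ℝ} (hx : x 2 ≠ 0) :
    Function.Surjective (fderiv ℝ (jetData (x 0)) x) := fun w => by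
  have h : jet (x 0) (jetData (x 0) x) = x := evol_self hx
  have := fderiv_jetData_jet (x 0) (jetData_one_ne_zero hx (reachesTime_self x).dev_ne) w
  rw [h] at this
  exact ⟨_, this⟩

theorem isQuotientStructure_solutionChartedSpace : IsQuotientStructure solutionChartedSpace := by
  let := solutionChartedSpace
  have hman : IsManifold 𝓘(ℝ, Fin 4 → ℝ) ∞ SolutionSpace := isManifold_solutionChartedSpace
  have hatlas (s : ℝ) : timeChart s ∈ IsManifold.maximalAtlas 𝓘(ℝ, Fin 4 → ℝ) ∞ SolutionSpace :=
    IsManifold.subset_maximalAtlas ⟨s, rfl⟩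
  have hdiff : ContMDiff 𝓘(ℝ, Fin 5 → ℝ) 𝓘(ℝ, Fin 4 → ℝ) ∞ toSolution := fun x => by
    set s := (x : Fin 5 → ℝ) 0 with hs
    have h1 : ContMDiffAt 𝓘(ℝ, Fin 5 → ℝ) 𝓘(ℝ, Fin 4 → ℝ) ∞ (fun y : jetSpace => jetData s y) x :=
      contMDiffAt_subtype_iff.2
        (contDiffAt_jetData x.2 (reachesTime_self x).dev_ne).contMDiffAt
    have h2 : jetData s x ∈ (timeChart s).target :=
      jetData_one_ne_zero x.2 (reachesTime_self x).dev_ne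
    have h3 := (contMDiffAt_symm_of_mem_maximalAtlas (hatlas s) h2).comp x h1
    refine h3.congr_of_eventuallyEq ?_
    have h4 := continuousAt_subtype_val.eventually
      ((reachesTime_self (x : Fin 5 → ℝ)).eventually_left x.2)
    filter_upwards [h4] with y hy using (toSolution_jetOn_jetData hy).symm
  refine ⟨hman, hdiff, fun x => ?_⟩
  set s := (x : Fin 5 → ℝ) 0 with hs
  have hx : toSolution x ∈ (timeChart s).source := reachesTime_rep_iff.2 (reachesTime_self x)
  have h1 := ((contMDiffAt_of_mem_maximalAtlas (hatlas s) hx).mdifferentiableAt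
    (by simp)).hasMFDerivAt
  have h0 := hasMFDerivAt_toSolutionExt hdiff x
  rw [← toSolutionExt_coe x] at h1
  have h2 := HasMFDerivAt.comp _ h1 h0
  have h3 : (timeChart s ∘ toSolutionExt) =ᶠ[nhds (x : Fin 5 → ℝ)] jetData s := by
    filter_upwards [(reachesTime_self (x : Fin 5 → ℝ)).eventually_left x.2,
      jetSpace_mem_nhds x.2] with y hy hy2
    rw [Function.comp_apply, toSolutionExt_coe ⟨y, hy2⟩]
    exact jetData_rep (x := ⟨y, hy2⟩) hy
  have h4 := ((contDiffAt_jetData x.2 (reachesTime_self (x : Fin 5 → ℝ)).dev_ne).differentiableAt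
    (by simp)).hasFDerivAt.hasMFDerivAt.congr_of_eventuallyEq h3
  have h5 := hasMFDerivAt_unique h2 h4
  set D : (Fin 4 → ℝ) →L[ℝ] (Fin 4 → ℝ) := mfderiv 𝓘(ℝ, Fin 4 → ℝ) 𝓘(ℝ, Fin 4 → ℝ)
    (timeChart s) (toSolutionExt x)
  have h6 : ∀ ξ, D (quotDeriv x ξ) = fderiv ℝ (jetData s) x ξ := fun ξ =>
    congrArg (fun L : (Fin 5 → ℝ) →L[ℝ] (Fin 4 → ℝ) => L ξ) h5
  -- The composite D ∘ dπ is onto, hence so is D; between spaces of equal dimension D is then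
  -- injective, and surjectivity passes back to dπ.
  have h7 : Function.Surjective D.toLinearMap := fun w => by
    obtain ⟨ξ, hξ⟩ := fderiv_jetData_surjective x.2 w
    exact ⟨quotDeriv x ξ, (h6 ξ).trans hξ⟩
  have h8 : Function.Injective D.toLinearMap := LinearMap.injective_iff_surjective.2 h7
  intro w
  obtain ⟨ξ, hξ⟩ := fderiv_jetData_surjective x.2 (D w)
  exact ⟨ξ, h8 ((h6 ξ).trans hξ)⟩

/-! ### Variation in the direction ∂_r as a Jacobi field -/

/-- The derivative of `dev x s` with respect to half the Schwarzian of the jet `x`. -/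
def devVar (x : Fin 5 → ℝ) (s : ℝ) : ℝ :=
  oscCσ (schwarzian x / 2) (s - x 0) - jetV x / 2 * oscSσ (schwarzian x / 2) (s - x 0)

/-- The derivative of `devDeriv x s` with respect to half the Schwarzian of the jet `x`. -/
def devDerivVar (x : Fin 5 → ℝ) (s : ℝ) : ℝ :=
  -oscS (schwarzian x / 2) (s - x 0) - schwarzian x / 2 * oscSσ (schwarzian x / 2) (s - x 0)
    - jetV x / 2 * oscCσ (schwarzian x / 2) (s - x 0)

/-- The energy identity and its σ-derivative eliminate the σ-derivatives of C and S in favour of K.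
-/
theorem devVar_eq (x : Fin 5 → ℝ) (s : ℝ) :
    devVar x s = 2 * devDeriv x s * oscK (schwarzian x / 2) (s - x 0)
      - dev x s * (oscS (schwarzian x / 2) (s - x 0) ^ 2 / 2) := by
  rw [dev, devDeriv, devVar, oscK]
  set C := oscC (schwarzian x / 2) (s - x 0)
  set S := oscS (schwarzian x / 2) (s - x 0)
  set Cσ := oscCσ (schwarzian x / 2) (s - x 0)
  set Sσ := oscSσ (schwarzian x / 2) (s - x 0)
  linear_combination (C - jetV x / 2 * S) / 2 * oscC_sq_deriv (schwarzian x / 2) (s - x 0)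
    - (Cσ - jetV x / 2 * Sσ) * oscC_sq_add (schwarzian x / 2) (s - x 0)

/-- The time derivative of the formula for `devVar`, using E'' = -(S/2)E and K' = `oscS ^ 2 / 2`. -/
theorem devDerivVar_eq (x : Fin 5 → ℝ) (s : ℝ) :
    devDerivVar x s = devDeriv x s * (oscS (schwarzian x / 2) (s - x 0) ^ 2 / 2)
      - schwarzian x * dev x s * oscK (schwarzian x / 2) (s - x 0)
      - oscS (schwarzian x / 2) (s - x 0) * oscC (schwarzian x / 2) (s - x 0) * dev x s := by
  rw [dev, devDeriv, devDerivVar, oscK]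
  set C := oscC (schwarzian x / 2) (s - x 0)
  set S := oscS (schwarzian x / 2) (s - x 0)
  set Cσ := oscCσ (schwarzian x / 2) (s - x 0)
  set Sσ := oscSσ (schwarzian x / 2) (s - x 0)
  linear_combination (-(schwarzian x / 2) * S - jetV x / 2 * C) / 2
      * oscC_sq_deriv (schwarzian x / 2) (s - x 0)
    - (-S - schwarzian x / 2 * Sσ - jetV x / 2 * Cσ)
      * oscC_sq_add (schwarzian x / 2) (s - x 0)

/-- The differential of the data at time `s` of a solution in the direction `∂_r`. -/
theorem fderiv_jetData_coordVec {x : Fin 5 → ℝ} {s : ℝ} (hx : x 2 ≠ 0) (hs : dev x s ≠ 0) :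
    fderiv ℝ (jetData s) x (coordVec 4) =
      ![oscK (schwarzian x / 2) (s - x 0) / dev x s ^ 2, -devVar x s / dev x s ^ 3,
        -(devDerivVar x s * dev x s - devDeriv x s * devVar x s) / (x 2 * dev x s ^ 2),
        1 / x 2] := by
  refine fderiv_apply_eq_of_line ((contDiffAt_jetData hx hs).differentiableAt (by simp)) ?_
  set L : ℝ → (Fin 5 → ℝ) := fun h => x + h • coordVec 4 with hL
  have e0 : ∀ h, L h 0 = x 0 := fun h => by simp [hL, coordVec]
  have e1 : ∀ h, L h 1 = x 1 := fun h => by simp [hL, coordVec]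
  have e2 : ∀ h, L h 2 = x 2 := fun h => by simp [hL, coordVec]
  have e3 : ∀ h, L h 3 = x 3 := fun h => by simp [hL, coordVec]
  have e4 : ∀ h, L h 4 = x 4 + h := fun h => by simp [hL, coordVec]
  have eL : L 0 = x := by simp [hL]
  have eV : ∀ h, jetV (L h) = jetV x := fun h => by simp only [jetV, e2, e3]
  have eS : ∀ h, schwarzian (L h) = schwarzian x + h / x 2 := fun h => by
    simp only [schwarzian, e2, e3, e4]; ring
  have hS : HasDerivAt (fun h => schwarzian (L h)) (1 / x 2) 0 := by
    simp only [eS]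
    exact ((hasDerivAt_id (0 : ℝ)).div_const (x 2)).const_add _
  have hS2 := hS.div_const 2
  have hC' : HasDerivAt (fun h => oscC (schwarzian (L h) / 2) (s - x 0))
      (oscCσ (schwarzian x / 2) (s - x 0) * (1 / x 2 / 2)) 0 :=
    HasDerivAt.comp (h := fun h => schwarzian (L h) / 2) (h₂ := fun σ => oscC σ (s - x 0)) (0 : ℝ)
      (by simp only [eL]; exact hasDerivAt_oscC_left (schwarzian x / 2) (s - x 0)) hS2
  have hS' : HasDerivAt (fun h => oscS (schwarzian (L h) / 2) (s - x 0))
      (oscSσ (schwarzian x / 2) (s - x 0) * (1 / x 2 / 2)) 0 :=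
    HasDerivAt.comp (h := fun h => schwarzian (L h) / 2) (h₂ := fun σ => oscS σ (s - x 0)) (0 : ℝ)
      (by simp only [eL]; exact hasDerivAt_oscS_left (schwarzian x / 2) (s - x 0)) hS2
  have hE : HasDerivAt (fun h => dev (L h) s) (devVar x s / (2 * x 2)) 0 := by
    simp only [dev, eV, e0]
    refine (hC'.sub (hS'.const_mul (jetV x / 2))).congr_deriv ?_
    rw [devVar]
    field_simp
  have hE' : HasDerivAt (fun h => devDeriv (L h) s) (devDerivVar x s / (2 * x 2)) 0 := by
    simp only [devDeriv, eV, e0]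
    refine ((hS2.neg.mul hS').sub (hC'.const_mul (jetV x / 2))).congr_deriv ?_
    simp only [devDerivVar, Pi.neg_apply, eL]
    field_simp
    ring
  have hs' : dev (L 0) s ≠ 0 := by rwa [eL]
  change HasDerivAt (fun h => jetData s (L h)) _ 0
  rw [hasDerivAt_pi]
  intro i
  fin_cases i
  · simp only [jetData, e0, e1, e2]
    refine (((hS'.const_mul (x 2)).div hE hs').const_add (x 1)).congr_deriv ?_
    simp only [eL, oscK, dev, devVar] at hs ⊢
    simp
    field_simp
    ring
  · simp only [jetData, e2]
    refine ((hasDerivAt_const (0 : ℝ) (x 2)).div (hE.pow 2) (pow_ne_zero 2 hs')).congr_deriv ?_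
    simp [eL]
    field_simp
  · refine ((hE'.const_mul (-2)).div hE hs').congr_deriv ?_
    simp [eL]
    field_simp
    ring
  · exact hS

/-- The 2-jet of the Jacobi field `f u'` divided by `u'`, and the variation of the Schwarzian, as
functions of the variations of `u, u', u'' / u', S`. -/
def jacobiMap (z : Fin 4 → ℝ) : (Fin 4 → ℝ) →ₗ[ℝ] (Fin 4 → ℝ) where
  -- Solves δu = f u', δu' = u'(f' + vf), δv = f'' + vf' + v'f successively for f, f', f'', with v'
  -- = S + v²/2.
  toFun δ := ![δ 3, δ 0 / z 1, δ 1 / z 1 - z 2 * (δ 0 / z 1),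
    δ 2 - z 2 * (δ 1 / z 1 - z 2 * (δ 0 / z 1)) - (z 3 + z 2 ^ 2 / 2) * (δ 0 / z 1)]
  map_add' a b := by
    ext i
    fin_cases i <;> simp <;> ring
  map_smul' a b := by
    ext i
    fin_cases i <;> simp <;> ring

theorem jacobiMap_injective {z : Fin 4 → ℝ} (hz : z 1 ≠ 0) :
    Function.Injective (jacobiMap z) := by
  rw [injective_iff_map_eq_zero]
  intro δ h
  have h0 : δ 3 = 0 := congrFun h 0
  have h1 : δ 0 / z 1 = 0 := congrFun h 1
  have h2 : δ 1 / z 1 - z 2 * (δ 0 / z 1) = 0 := congrFun h 2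
  have h3 : δ 2 - z 2 * (δ 1 / z 1 - z 2 * (δ 0 / z 1)) - (z 3 + z 2 ^ 2 / 2) * (δ 0 / z 1) = 0 :=
    congrFun h 3
  rw [h2, h1] at h3
  rw [h1] at h2
  have h4 : δ 0 = 0 := by simpa [hz] using h1
  have h5 : δ 1 = 0 := by simpa [hz] using h2
  have h6 : δ 2 = 0 := by simpa using h3
  ext i
  fin_cases i <;> simp [h0, h4, h5, h6]

/-- The solution of `f'''' + 4 σ f'' = 0` with 3-jet `(0, 0, 0, 1)` at `0`, and its derivatives. -/
def oscVec (σ t : ℝ) : Fin 4 → ℝ := ![1, oscK σ t, oscS σ t ^ 2 / 2, oscS σ t * oscC σ t]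

/-- Varying r alone leaves u, u', u'' fixed at the initial time and changes u''' at unit rate, so f
has 3-jet (0, 0, 0, 1/p) there and equals K/p. All dependence on v disappears. -/
theorem jacobiMap_fderiv_jetData {x : Fin 5 → ℝ} {s : ℝ} (hx : x 2 ≠ 0) (hs : dev x s ≠ 0) :
    jacobiMap (jetData s x) (fderiv ℝ (jetData s) x (coordVec 4))
      = (1 / x 2) • oscVec (schwarzian x / 2) (s - x 0) := by
  rw [fderiv_jetData_coordVec hx hs]
  have z1 : jetData s x 1 = x 2 / dev x s ^ 2 := rfl
  have z2 : jetData s x 2 = -2 * devDeriv x s / dev x s := rfl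
  have z3 : jetData s x 3 = schwarzian x := rfl
  have i0 : oscK (schwarzian x / 2) (s - x 0) / dev x s ^ 2 / (x 2 / dev x s ^ 2)
      = oscK (schwarzian x / 2) (s - x 0) / x 2 := by field_simp
  have i1 : -devVar x s / dev x s ^ 3 / (x 2 / dev x s ^ 2)
      - -2 * devDeriv x s / dev x s * (oscK (schwarzian x / 2) (s - x 0) / x 2)
      = oscS (schwarzian x / 2) (s - x 0) ^ 2 / 2 / x 2 := by
    rw [devVar_eq]; field_simp; ring
  ext i
  fin_cases i
  · simp [jacobiMap, oscVec]
  · simp only [jacobiMap, z1, oscVec, LinearMap.coe_mk, AddHom.coe_mk]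
    simp
    field_simp
  · simp only [jacobiMap, z1, z2, LinearMap.coe_mk, AddHom.coe_mk]
    simp only [oscVec, Matrix.cons_val_zero, Matrix.cons_val_one, Matrix.cons_val, Fin.reduceFinMk,
      i0, i1, Pi.smul_apply, smul_eq_mul]
    ring
  · simp only [jacobiMap, z1, z2, z3, LinearMap.coe_mk, AddHom.coe_mk]
    simp only [oscVec, Matrix.cons_val_zero, Matrix.cons_val_one, Matrix.cons_val, Fin.reduceFinMk,
      i0, i1, Pi.smul_apply, smul_eq_mul]
    rw [devVar_eq, devDerivVar_eq]
    field_simp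
    ring

/-! ### Closed forms, and the time interval of a leaf -/

/-- The solutions of `y'' = -σ y` are the combinations of `oscC σ` and `oscS σ`. -/
theorem eq_osc {f g : ℝ → ℝ} {σ : ℝ} (hf : ∀ t, HasDerivAt f (g t) t)
    (hg : ∀ t, HasDerivAt g (-σ * f t) t) (t : ℝ) :
    f t = f 0 * oscC σ t + g 0 * oscS σ t := by
  have ha : ∀ t, HasDerivAt (fun t => f t * oscC σ t - g t * oscS σ t) 0 t := fun t =>
    (((hf t).mul (hasDerivAt_oscC σ t)).sub ((hg t).mul (hasDerivAt_oscS σ t))).congr_deriv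
      (by ring)
  have hb : ∀ t, HasDerivAt (fun t => σ * (f t * oscS σ t) + g t * oscC σ t) 0 t := fun t =>
    ((((hf t).mul (hasDerivAt_oscS σ t)).const_mul σ).add
      ((hg t).mul (hasDerivAt_oscC σ t))).congr_deriv (by ring)
  have ha' := is_const_of_deriv_eq_zero (fun t => (ha t).differentiableAt)
    (fun t => (ha t).deriv) t 0
  have hb' := is_const_of_deriv_eq_zero (fun t => (hb t).differentiableAt)
    (fun t => (hb t).deriv) t 0
  simp at ha' hb'
  linear_combination oscC σ t * ha' + oscS σ t * hb' - f t * oscC_sq_add σ t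

/-- Both sides vanish at 0 and have derivative 2σ `oscS ^ 2`. For σ ≠ 0 this determines K; for σ = 0
it does not, and K is integrated separately. -/
theorem four_mul_oscK (σ t : ℝ) : 4 * σ * oscK σ t = t - oscS σ t * oscC σ t := by
  have h : ∀ t, HasDerivAt (fun t => 4 * σ * oscK σ t - (t - oscS σ t * oscC σ t)) 0 t :=
    fun t => (((hasDerivAt_oscK σ t).const_mul (4 * σ)).sub ((hasDerivAt_id t).sub
      ((hasDerivAt_oscS σ t).mul (hasDerivAt_oscC σ t)))).congr_deriv
        (by linear_combination oscC_sq_add σ t)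
  have := is_const_of_deriv_eq_zero (fun t => (h t).differentiableAt) (fun t => (h t).deriv) t 0
  simp at this
  linarith

theorem SameLeaf.schwarzian_eq {x y : jetSpace} (h : SameLeaf x y) :
    schwarzian y = schwarzian x := by
  rw [h.2, schwarzian_evol x.2 h.1.dev_ne]

theorem range_leaf_time (y : jetSpace) :
    Set.range (Leaf.time (s := toSolution y)) = {t | ReachesTime y t} := by
  ext t
  constructor
  · rintro ⟨⟨x, hx⟩, rfl⟩
    exact (toSolution_eq_iff.1 hx.symm).1
  · intro ht
    have hx : evol t y 2 ≠ 0 := evol_two_ne_zero y.2 (ReachesTime.dev_ne ht)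
    exact ⟨⟨⟨evol t y, hx⟩, ((toSolution_eq_iff (x := y)
      (y := ⟨evol t y, hx⟩)).2 ⟨ht, rfl⟩).symm⟩, rfl⟩

theorem isOpen_setOf_reachesTime {x : Fin 5 → ℝ} (hx : x 2 ≠ 0) :
    IsOpen {t | ReachesTime x t} :=
  isOpen_iff_mem_nhds.2 fun t ht =>
    (Continuous.tendsto (by fun_prop : Continuous fun s : ℝ => (x, s)) t).eventually
      (ReachesTime.eventually hx ht)

theorem ordConnected_setOf_reachesTime (x : Fin 5 → ℝ) :
    Set.OrdConnected {t | ReachesTime x t} := by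
  refine ⟨fun a ha b hb c hc => ?_⟩
  rcases le_total (x 0) c with h | h
  · exact ReachesTime.mono hb (Set.mem_uIcc.2 (Or.inl ⟨h, hc.2⟩))
  · exact ReachesTime.mono ha (Set.mem_uIcc.2 (Or.inr ⟨hc.1, h⟩))

theorem totalField_ne_zero (F : (Fin 5 → ℝ) → ℝ) (x : Fin 5 → ℝ) : totalField F x ≠ 0 :=
  fun h => one_ne_zero (congrFun h 0)

theorem fderiv_jetData_totalField {x : Fin 5 → ℝ} (hx : x 2 ≠ 0) :
    fderiv ℝ (jetData (x 0)) x (totalField eqRHS x) = 0 := by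
  have h0 := evol_self hx
  have h1 := hasDerivAt_evol hx (reachesTime_self x).dev_ne
  rw [h0] at h1
  have h2 : HasFDerivAt (jetData (x 0)) (fderiv ℝ (jetData (x 0)) x) (evol (x 0) x) := by
    rw [h0]
    exact ((contDiffAt_jetData hx (reachesTime_self x).dev_ne).differentiableAt
      (by simp)).hasFDerivAt
  have h3 := h2.comp_hasDerivAt (f := fun r => evol r x) (x 0) h1
  have h4 : (jetData (x 0) ∘ fun r => evol r x) =ᶠ[nhds (x 0)] fun _ => jetData (x 0) x := by
    filter_upwards [(isOpen_setOf_reachesTime hx).mem_nhds (reachesTime_self x)] with s hs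
    exact jetData_evol hx (ReachesTime.dev_ne hs) (reachesTime_self x).dev_ne
  exact h3.unique ((hasDerivAt_const (x 0) _).congr_of_eventuallyEq h4)

/-! ### The projective curve for an arbitrary quotient structure -/

theorem map_mk_eq_mk {V W : Type*} [AddCommGroup V] [Module ℝ V] [AddCommGroup W] [Module ℝ W]
    (A : V ≃ₗ[ℝ] W) {v : V} {w : W} {a : ℝ} (hv : v ≠ 0) (hw : w ≠ 0) (h : A v = a • w) :
    (Projectivization.mk ℝ v hv).map A.toLinearMap A.injective = Projectivization.mk ℝ w hw := by
  rw [Projectivization.map_mk, Projectivization.mk_eq_mk_iff']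
  exact ⟨a, h.symm⟩

section structures
variable [M : ChartedSpace (Fin 4 → ℝ) SolutionSpace]

theorem quotDeriv_surjective (hM : IsQuotientStructure M) (x : jetSpace) :
    Function.Surjective (quotDeriv x) := hM.2.2 x

/-- The kernel has dimension 5 - 4 = 1 and contains the nonzero vector X_F. -/
theorem ker_quotDeriv (hM : IsQuotientStructure M) (x : jetSpace) :
    LinearMap.ker (quotDeriv x).toLinearMap = Submodule.span ℝ {totalField eqRHS x} := by
  symm
  apply Submodule.eq_of_le_of_finrank_eq
  · rw [Submodule.span_singleton_le_iff_mem]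
    exact quotDeriv_totalField hM.2.1 x
  · have h1 := LinearMap.finrank_range_add_finrank_ker (quotDeriv x).toLinearMap
    rw [LinearMap.range_eq_top.2 (quotDeriv_surjective hM x), finrank_top] at h1
    simp at h1
    rw [finrank_span_singleton (totalField_ne_zero _ _)]
    omega

/-- The data at the time of a jet `y` are coordinates of the tangent space at its solution. -/
theorem exists_tangentEquiv (hM : IsQuotientStructure M) (y : jetSpace) :
    ∃ B : (Fin 4 → ℝ) ≃ₗ[ℝ] (Fin 4 → ℝ), ∀ ξ,
      B (quotDeriv y ξ) = fderiv ℝ (jetData ((y : Fin 5 → ℝ) 0)) y ξ := by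
  set L := fderiv ℝ (jetData ((y : Fin 5 → ℝ) 0)) (y : Fin 5 → ℝ) with hL
  -- The choice of section is harmless: two lifts differ by a multiple of X_F, which L kills.
  obtain ⟨g, hg⟩ := (quotDeriv y).toLinearMap.exists_rightInverse_of_surjective
    (LinearMap.range_eq_top.2 (quotDeriv_surjective hM y))
  have hg' : ∀ w, quotDeriv y (g w) = w := fun w => LinearMap.congr_fun hg w
  have hB : ∀ ξ, (L.toLinearMap ∘ₗ g) (quotDeriv y ξ) = L ξ := fun ξ => by
    have h1 : g (quotDeriv y ξ) - ξ ∈ LinearMap.ker (quotDeriv y).toLinearMap := by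
      simp [hg']
    rw [ker_quotDeriv hM, Submodule.mem_span_singleton] at h1
    obtain ⟨a, ha⟩ := h1
    have h2 : L (g (quotDeriv y ξ) - ξ) = 0 := by
      rw [← ha, map_smul, hL, fderiv_jetData_totalField y.2, smul_zero]
    rw [map_sub, sub_eq_zero] at h2
    exact h2
  have hsurj : Function.Surjective (L.toLinearMap ∘ₗ g) := fun w => by
    obtain ⟨ξ, hξ⟩ := fderiv_jetData_surjective y.2 w
    exact ⟨quotDeriv y ξ, (hB ξ).trans hξ⟩
  exact ⟨LinearEquiv.ofBijective _ ⟨LinearMap.injective_iff_surjective.2 hsurj, hsurj⟩, hB⟩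

theorem tangentEquiv_quotDeriv (hM : IsQuotientStructure M) {x y : jetSpace} (h : SameLeaf x y)
    {B : (Fin 4 → ℝ) ≃ₗ[ℝ] (Fin 4 → ℝ)}
    (hB : ∀ ξ, B (quotDeriv y ξ) = fderiv ℝ (jetData ((y : Fin 5 → ℝ) 0)) y ξ) (ξ : Fin 5 → ℝ) :
    B (quotDeriv x ξ) = fderiv ℝ (jetData ((y : Fin 5 → ℝ) 0)) x ξ := by
  rw [← quotDeriv_evol hM.2.1 h, hB]
  obtain ⟨hs, he⟩ := h
  set s := (y : Fin 5 → ℝ) 0 with hsd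
  have h1 : HasFDerivAt (evol s) (fderiv ℝ (evol s) x) (x : Fin 5 → ℝ) :=
    (((contDiff_jet s).contDiffAt.comp _ (contDiffAt_jetData x.2 hs.dev_ne)).differentiableAt
      (by simp)).hasFDerivAt
  have h2 : HasFDerivAt (jetData s) (fderiv ℝ (jetData s) y) (evol s (x : Fin 5 → ℝ)) := by
    rw [← he]
    exact ((contDiffAt_jetData y.2 (reachesTime_self (y : Fin 5 → ℝ)).dev_ne).differentiableAt
      (by simp)).hasFDerivAt
  have h3 := h2.comp (x : Fin 5 → ℝ) h1
  have h4 : jetData s ∘ evol s =ᶠ[nhds (x : Fin 5 → ℝ)] jetData s := by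
    filter_upwards [hs.eventually_left x.2, jetSpace_mem_nhds x.2] with z hz hz2
      using jetData_evol hz2 hz.dev_ne hz.dev_ne
  have h5 := (h3.congr_of_eventuallyEq h4.symm).fderiv
  rw [h5]
  rfl

theorem quotDeriv_coordVec_ne_zero (hM : IsQuotientStructure M) (x : jetSpace) :
    quotDeriv x (coordVec 4) ≠ 0 := fun h => by
  obtain ⟨B, hB⟩ := exists_tangentEquiv hM x
  have h1 := hB (coordVec 4)
  rw [h, map_zero, fderiv_jetData_coordVec x.2 (reachesTime_self (x : Fin 5 → ℝ)).dev_ne] at h1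
  exact one_div_ne_zero x.2 (congrFun h1 3).symm

/-- The field of curves `π_* (span ∂_r)` in the projective tangent bundle of the solution space. -/
def verticalCurve (hM : IsQuotientStructure M) (s : SolutionSpace) (x : Leaf s) :
    ℙ ℝ (TangentSpace 𝓘(ℝ, Fin 4 → ℝ) s) :=
  Projectivization.mk ℝ (V := TangentSpace 𝓘(ℝ, Fin 4 → ℝ) s) (quotDeriv x.1 (coordVec 4))
    (quotDeriv_coordVec_ne_zero hM x.1)

theorem submodule_verticalCurve (hM : IsQuotientStructure M) (x : jetSpace) :
    (verticalCurve hM (toSolution x) ⟨x, rfl⟩).submodule = verticalImage x := by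
  refine (Projectivization.submodule_mk _ _).trans (Eq.symm ?_)
  exact (Submodule.map_span _ _).trans (congrArg _ Set.image_singleton)

/-- All tangent vectors are read at the fixed time t₀ of y. The Jacobi field of ∂_r at time t starts
at t and is evaluated at t₀, hence the argument t₀ - t; its factor 1/p is invisible projectively. It
remains to find a constant matrix H onto the model curve. -/
theorem isProjectivelyEquivalent_verticalCurve (hM : IsQuotientStructure M) (y : jetSpace)
    {Γ : ℝ → (Fin 3 → ℝ)} {κ : ℝ} (hκ : 0 < κ) {H : (Fin 4 → ℝ) →ₗ[ℝ] (Fin 4 → ℝ)}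
    (hH : Function.Injective H)
    (hΓ : ∀ t, H (oscVec (schwarzian y / 2) ((y : Fin 5 → ℝ) 0 - t))
      = Matrix.vecCons 1 (Γ (κ * t))) :
    IsProjectivelyEquivalent (verticalCurve hM (toSolution y)) Γ := by
  obtain ⟨B, hB⟩ := exists_tangentEquiv hM y
  have hz := jetData_one_ne_zero y.2 (reachesTime_self (y : Fin 5 → ℝ)).dev_ne
  set t₀ := (y : Fin 5 → ℝ) 0 with ht₀
  have hinj : Function.Injective (H ∘ₗ jacobiMap (jetData t₀ y) ∘ₗ B.toLinearMap) :=
    hH.comp ((jacobiMap_injective hz).comp B.injective)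
  let A : (Fin 4 → ℝ) ≃ₗ[ℝ] (Fin 4 → ℝ) := LinearEquiv.ofInjectiveEndo _ hinj
  refine ⟨?_, ?_, A, κ, hκ, ?_⟩
  · rw [range_leaf_time]
    exact isOpen_setOf_reachesTime y.2
  · rw [range_leaf_time]
    exact ordConnected_setOf_reachesTime _
  rintro ⟨x, hx⟩
  have hxy : SameLeaf x y := toSolution_eq_iff.1 hx
  have hA : A (quotDeriv x (coordVec 4))
      = (1 / (x : Fin 5 → ℝ) 2) • Matrix.vecCons 1 (Γ (κ * (x : Fin 5 → ℝ) 0)) := by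
    change H (jacobiMap (jetData t₀ y) (B (quotDeriv x (coordVec 4)))) = _
    rw [tangentEquiv_quotDeriv hM hxy hB, hxy.jetData_eq hxy.1,
      jacobiMap_fderiv_jetData x.2 hxy.1.dev_ne, map_smul, ← hxy.schwarzian_eq, hΓ]
  exact map_mk_eq_mk (V := TangentSpace 𝓘(ℝ, Fin 4 → ℝ) (toSolution y)) A _ _ hA

end structures

/-! ### The model curves for the three signs of S -/

theorem oscC_oscS_of_pos {k : ℝ} (hk : 0 < k) (t : ℝ) :
    oscC (k ^ 2) t = Real.cos (k * t) ∧ oscS (k ^ 2) t = Real.sin (k * t) / k := by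
  have hc : ∀ t, HasDerivAt (fun t => Real.cos (k * t)) (-k * Real.sin (k * t)) t := fun t =>
    (((hasDerivAt_id t).const_mul k).cos).congr_deriv (by simp; ring)
  have hs : ∀ t, HasDerivAt (fun t => Real.sin (k * t)) (k * Real.cos (k * t)) t := fun t =>
    (((hasDerivAt_id t).const_mul k).sin).congr_deriv (by simp; ring)
  have h1 := eq_osc (σ := k ^ 2) hc (fun t => ((hs t).const_mul (-k)).congr_deriv (by ring)) t
  have h2 := eq_osc (σ := k ^ 2) hs (fun t => ((hc t).const_mul k).congr_deriv (by ring)) t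
  simp at h1 h2
  refine ⟨h1.symm, ?_⟩
  rw [h2]
  field_simp

theorem exp_eq_osc (k t : ℝ) :
    Real.exp (k * t) = oscC (-k ^ 2) t + k * oscS (-k ^ 2) t := by
  have he : ∀ t, HasDerivAt (fun t => Real.exp (k * t)) (k * Real.exp (k * t)) t := fun t =>
    (((hasDerivAt_id t).const_mul k).exp).congr_deriv (by simp; ring)
  have h := eq_osc (σ := -k ^ 2) he (fun t => ((he t).const_mul k).congr_deriv (by ring)) t
  simpa using h

theorem oscC_oscS_oscK_zero (t : ℝ) :
    oscC 0 t = 1 ∧ oscS 0 t = t ∧ oscK 0 t = t ^ 3 / 6 := by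
  have hS : ∀ t, oscS 0 t = t := fun t => by
    have := eq_osc (σ := 0) (f := fun t => t) (g := fun _ => 1) hasDerivAt_id
      (fun t => (hasDerivAt_const t 1).congr_deriv (by simp)) t
    simpa using this.symm
  have hC := eq_osc (σ := 0) (f := fun _ => 1) (g := fun _ => 0) (fun t => hasDerivAt_const t 1)
    (fun t => (hasDerivAt_const t 0).congr_deriv (by simp)) t
  have hK : ∀ t, HasDerivAt (fun t => oscK 0 t - t ^ 3 / 6) 0 t := fun t =>
    ((hasDerivAt_oscK 0 t).sub (((hasDerivAt_id t).pow 3).div_const 6)).congr_deriv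
      (by simp [hS]; ring)
  have h := is_const_of_deriv_eq_zero (fun t => (hK t).differentiableAt)
    (fun t => (hK t).deriv) t 0
  simp at h
  exact ⟨by simpa using hC.symm, hS t, by linarith⟩

theorem exists_linear_of_schwarzian_zero (t₀ : ℝ) :
    ∃ H : (Fin 4 → ℝ) →ₗ[ℝ] (Fin 4 → ℝ), Function.Injective H ∧
      ∀ t, H (oscVec 0 (t₀ - t)) = Matrix.vecCons 1 ![t, t ^ 2, t ^ 3] := by
  -- With τ = t₀ - t the vector is (1, τ³/6, τ²/2, τ); the rows expand the powers of t = t₀ - τ.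
  refine ⟨Matrix.toLin' !![1, 0, 0, 0; t₀, 0, 0, -1; t₀ ^ 2, 0, 2, -2 * t₀;
    t₀ ^ 3, -6, 6 * t₀, -3 * t₀ ^ 2], ?_, fun t => ?_⟩
  · rw [injective_iff_map_eq_zero]
    intro z h
    have h0 := congrFun h 0
    have h1 := congrFun h 1
    have h2 := congrFun h 2
    have h3 := congrFun h 3
    simp [Matrix.toLin'_apply, Matrix.mulVec, dotProduct, Fin.sum_univ_four] at h0 h1 h2 h3
    rw [h0] at h1 h2 h3
    have z3 : z 3 = 0 := by linarith
    rw [z3] at h2 h3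
    have z2 : z 2 = 0 := by linarith
    rw [z2] at h3
    have z1 : z 1 = 0 := by linarith
    ext i
    fin_cases i <;> assumption
  · obtain ⟨hC, hS, hK⟩ := oscC_oscS_oscK_zero (t₀ - t)
    ext i
    fin_cases i <;>
      simp [Matrix.toLin'_apply, Matrix.mulVec, dotProduct, Fin.sum_univ_four, oscVec, hC, hS, hK]
      <;> ring

theorem exists_linear_of_schwarzian_pos {k : ℝ} (hk : 0 < k) (t₀ : ℝ) :
    ∃ H : (Fin 4 → ℝ) →ₗ[ℝ] (Fin 4 → ℝ), Function.Injective H ∧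
      ∀ t, H (oscVec (k ^ 2) (t₀ - t)) = Matrix.vecCons 1
        ![2 * k * t - Real.sin (2 * k * t), Real.cos (2 * k * t),
          2 * k * t + Real.sin (2 * k * t)] := by
  set c := Real.cos (2 * k * t₀) with hc
  set s := Real.sin (2 * k * t₀) with hs
  have hcs : c ^ 2 + s ^ 2 = 1 := Real.cos_sq_add_sin_sq _
  -- With τ = t₀ - t and coordinates z of the vector, τ = 4k²z₁ + z₃, cos 2kτ = 1 - 4k²z₂ and sin
  -- 2kτ = 2kz₃; the rows follow from the subtraction formulas at 2kt₀ - 2kτ.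
  refine ⟨Matrix.toLin' !![1, 0, 0, 0;
    2 * k * t₀ - s, -8 * k ^ 3, 4 * k ^ 2 * s, -2 * k + 2 * k * c;
    c, 0, -4 * k ^ 2 * c, 2 * k * s;
    2 * k * t₀ + s, -8 * k ^ 3, -4 * k ^ 2 * s, -2 * k - 2 * k * c], ?_, fun t => ?_⟩
  · rw [injective_iff_map_eq_zero]
    intro z h
    have h0 := congrFun h 0
    have h1 := congrFun h 1
    have h2 := congrFun h 2
    have h3 := congrFun h 3
    simp [Matrix.toLin'_apply, Matrix.mulVec, dotProduct, Fin.sum_univ_four] at h0 h1 h2 h3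
    rw [h0] at h1 h2 h3
    have e2 : k ^ 2 * z 2 = 0 := by
      linear_combination (-c / 4) * h2 + (s / 8) * (h1 - h3) - k ^ 2 * z 2 * hcs
    have e3 : k * z 3 = 0 := by
      linear_combination (s / 2) * h2 + (c / 4) * (h1 - h3) - k * z 3 * hcs
    have z2 : z 2 = 0 := by simpa [hk.ne'] using e2
    have z3 : z 3 = 0 := by simpa [hk.ne'] using e3
    rw [z2, z3] at h1
    have z1 : z 1 = 0 := by simpa [hk.ne'] using h1
    ext i
    fin_cases i <;> assumption
  · have hK := four_mul_oscK (k ^ 2) (t₀ - t)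
    obtain ⟨hC, hS⟩ := oscC_oscS_of_pos hk (t₀ - t)
    have e : 2 * k * t = 2 * k * t₀ - 2 * (k * (t₀ - t)) := by ring
    have hSk : k * oscS (k ^ 2) (t₀ - t) = Real.sin (k * (t₀ - t)) := by rw [hS]; field_simp
    set S := oscS (k ^ 2) (t₀ - t)
    set C := oscC (k ^ 2) (t₀ - t)
    have hR := oscC_sq_add (k ^ 2) (t₀ - t)
    have hcos : Real.cos (2 * k * t) = c * (1 - 2 * k ^ 2 * S ^ 2) + s * (2 * k * S * C) := by
      rw [e, Real.cos_sub, Real.cos_two_mul, Real.sin_two_mul, ← hSk, ← hC]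
      linear_combination 2 * c * hR
    have hsin : Real.sin (2 * k * t) = s * (1 - 2 * k ^ 2 * S ^ 2) - c * (2 * k * S * C) := by
      rw [e, Real.sin_sub, Real.cos_two_mul, Real.sin_two_mul, ← hSk, ← hC]
      linear_combination 2 * s * hR
    rw [hcos, hsin]
    ext i
    fin_cases i
    · simp [Matrix.toLin'_apply, Matrix.mulVec, dotProduct, Fin.sum_univ_four, oscVec]
    · simp [Matrix.toLin'_apply, Matrix.mulVec, dotProduct, Fin.sum_univ_four, oscVec]
      linear_combination -2 * k * hK
    · simp [Matrix.toLin'_apply, Matrix.mulVec, dotProduct, Fin.sum_univ_four, oscVec]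
      ring
    · simp [Matrix.toLin'_apply, Matrix.mulVec, dotProduct, Fin.sum_univ_four, oscVec]
      linear_combination -2 * k * hK

theorem exists_linear_of_schwarzian_neg {k : ℝ} (hk : 0 < k) (t₀ : ℝ) :
    ∃ H : (Fin 4 → ℝ) →ₗ[ℝ] (Fin 4 → ℝ), Function.Injective H ∧
      ∀ t, H (oscVec (-k ^ 2) (t₀ - t)) = Matrix.vecCons 1
        ![Real.exp (-(2 * k * t)), 2 * k * t, -Real.exp (2 * k * t)] := by
  set a := Real.exp (-(2 * k * t₀)) with ha
  set b := Real.exp (2 * k * t₀) with hb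
  have ha0 : a ≠ 0 := (Real.exp_pos _).ne'
  have hb0 : b ≠ 0 := (Real.exp_pos _).ne'
  -- Here τ = -4k²z₁ + z₃ and exp(±2kτ) = (C ± kS)² = 1 + 4k²z₂ ± 2kz₃, where C and S are the values
  -- of `oscC` and `oscS` at τ.
  refine ⟨Matrix.toLin' !![1, 0, 0, 0;
    a, 0, 4 * k ^ 2 * a, 2 * k * a;
    2 * k * t₀, 8 * k ^ 3, 0, -2 * k;
    -b, 0, -4 * k ^ 2 * b, 2 * k * b], ?_, fun t => ?_⟩
  · rw [injective_iff_map_eq_zero]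
    intro z h
    have h0 := congrFun h 0
    have h1 := congrFun h 1
    have h2 := congrFun h 2
    have h3 := congrFun h 3
    simp [Matrix.toLin'_apply, Matrix.mulVec, dotProduct, Fin.sum_univ_four] at h0 h1 h2 h3
    rw [h0] at h1 h2 h3
    have e1 : a * (2 * k ^ 2 * z 2 + k * z 3) = 0 := by linear_combination h1 / 2
    have e2 : b * (-(2 * k ^ 2 * z 2) + k * z 3) = 0 := by linear_combination h3 / 2
    have e1' := (mul_eq_zero.1 e1).resolve_left ha0
    have e2' := (mul_eq_zero.1 e2).resolve_left hb0
    have e3 : k ^ 2 * z 2 = 0 := by linarith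
    have e4 : k * z 3 = 0 := by linarith
    have z2 : z 2 = 0 := by simpa [hk.ne'] using e3
    have z3 : z 3 = 0 := by simpa [hk.ne'] using e4
    rw [z3] at h2
    have z1 : z 1 = 0 := by simpa [hk.ne'] using h2
    ext i
    fin_cases i <;> assumption
  · have hK := four_mul_oscK (-k ^ 2) (t₀ - t)
    have h1 := exp_eq_osc k (t₀ - t)
    have h2 := exp_eq_osc (-k) (t₀ - t)
    rw [neg_sq] at h2
    set S := oscS (-k ^ 2) (t₀ - t)
    set C := oscC (-k ^ 2) (t₀ - t)
    have hR : C ^ 2 + -k ^ 2 * S ^ 2 = 1 := oscC_sq_add (-k ^ 2) (t₀ - t)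
    have e1 : Real.exp (-(2 * k * t)) = a * (C + k * S) ^ 2 := by
      rw [← h1, ← Real.exp_nat_mul, ← Real.exp_add]
      congr 1; push_cast; ring
    have e2 : Real.exp (2 * k * t) = b * (C + -k * S) ^ 2 := by
      rw [← h2, ← Real.exp_nat_mul, ← Real.exp_add]
      congr 1; push_cast; ring
    rw [e1, e2]
    ext i
    fin_cases i
    · simp [Matrix.toLin'_apply, Matrix.mulVec, dotProduct, Fin.sum_univ_four, oscVec]
    · simp [Matrix.toLin'_apply, Matrix.mulVec, dotProduct, Fin.sum_univ_four, oscVec]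
      linear_combination -a * hR
    · simp [Matrix.toLin'_apply, Matrix.mulVec, dotProduct, Fin.sum_univ_four, oscVec]
      linear_combination -2 * k * hK
    · simp [Matrix.toLin'_apply, Matrix.mulVec, dotProduct, Fin.sum_univ_four, oscVec]
      linear_combination b * hR

/-! ### The three cases of the theorem -/

theorem verticalCurve_of_neg {M : ChartedSpace (Fin 4 → ℝ) SolutionSpace}
    (hM : IsQuotientStructure M) (y : jetSpace) (hy : schwarzian y < 0) :
    IsProjectivelyEquivalent (verticalCurve hM (toSolution y))
      (fun t => ![Real.exp (-t), t, -Real.exp t]) := by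
  set k := Real.sqrt (-(schwarzian y / 2)) with hk
  have hk0 : 0 < k := Real.sqrt_pos.2 (by linarith)
  have hk2 : schwarzian (y : Fin 5 → ℝ) / 2 = -k ^ 2 := by
    rw [hk, Real.sq_sqrt (by linarith)]; ring
  obtain ⟨H, hH, hΓ⟩ := exists_linear_of_schwarzian_neg hk0 ((y : Fin 5 → ℝ) 0)
  -- The field equation f'''' + 4σf'' = 0 has frequency twice that of y'' = -σy, whence κ = 2k =
  -- √(-2S).
  exact isProjectivelyEquivalent_verticalCurve hM y (κ := 2 * k) (by positivity) hH
    (fun t => by rw [hk2, hΓ])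

theorem verticalCurve_of_pos {M : ChartedSpace (Fin 4 → ℝ) SolutionSpace}
    (hM : IsQuotientStructure M) (y : jetSpace) (hy : 0 < schwarzian y) :
    IsProjectivelyEquivalent (verticalCurve hM (toSolution y))
      (fun t => ![t - Real.sin t, Real.cos t, t + Real.sin t]) := by
  set k := Real.sqrt (schwarzian y / 2) with hk
  have hk0 : 0 < k := Real.sqrt_pos.2 (by linarith)
  have hk2 : schwarzian (y : Fin 5 → ℝ) / 2 = k ^ 2 := by
    rw [hk, Real.sq_sqrt (by linarith)]
  obtain ⟨H, hH, hΓ⟩ := exists_linear_of_schwarzian_pos hk0 ((y : Fin 5 → ℝ) 0)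
  exact isProjectivelyEquivalent_verticalCurve hM y (κ := 2 * k) (by positivity) hH
    (fun t => by rw [hk2, hΓ])

theorem verticalCurve_of_zero {M : ChartedSpace (Fin 4 → ℝ) SolutionSpace}
    (hM : IsQuotientStructure M) (y : jetSpace) (hy : schwarzian y = 0) :
    IsProjectivelyEquivalent (verticalCurve hM (toSolution y)) (fun t => ![t, t ^ 2, t ^ 3]) := by
  obtain ⟨H, hH, hΓ⟩ := exists_linear_of_schwarzian_zero ((y : Fin 5 → ℝ) 0)
  exact isProjectivelyEquivalent_verticalCurve hM y one_pos hH
    (fun t => by rw [hy, zero_div, hΓ, one_mul])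

end

theorem mainTheorem4 :
    (∀ x ∈ jetSpace, wunschmannOne eqRHS x = 0 ∧
      wunschmannZero eqRHS x = -(36 / 100) * schwarzian x ^ 2) ∧
    (∃ M : ChartedSpace (Fin 4 → ℝ) SolutionSpace, IsQuotientStructure M) ∧
    ∀ M : ChartedSpace (Fin 4 → ℝ) SolutionSpace, IsQuotientStructure M →
      ∃ c : (s : SolutionSpace) → Leaf s → ℙ ℝ (TangentSpace 𝓘(ℝ, Fin 4 → ℝ) s),
        (∀ x : jetSpace, (c (toSolution x) ⟨x, rfl⟩).submodule = verticalImage x) ∧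
        ∀ (s : SolutionSpace) (x : Leaf s),
          (schwarzian x.1 < 0 → IsProjectivelyEquivalent (c s)
            (fun t => ![Real.exp (-t), t, -Real.exp t])) ∧
          (0 < schwarzian x.1 → IsProjectivelyEquivalent (c s)
            (fun t => ![t - Real.sin t, Real.cos t, t + Real.sin t])) ∧
          (schwarzian x.1 = 0 → IsProjectivelyEquivalent (c s)
            (fun t => ![t, t ^ 2, t ^ 3])) := by
  refine ⟨fun x hx => wunschmann_eqRHS hx, ⟨_, isQuotientStructure_solutionChartedSpace⟩,
    fun M hM => ⟨verticalCurve hM, submodule_verticalCurve hM, ?_⟩⟩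
  rintro s ⟨y, rfl⟩
  exact ⟨verticalCurve_of_neg hM y, verticalCurve_of_pos hM y, verticalCurve_of_zero hM y⟩
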